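/- Let $\lambda<0$, $\beta>0$, $\gamma>0$ be real with $\gamma-\lambda-\beta>-1$, let $n\ge 0$ be an integer, and for $t\ge 0$ let $$w(x;t)=(x+t)^{-(\lambda+\beta)}x^{\gamma}e^{-x-t},\qquad x\in(0,\infty).$$ Let $P_j(x)=P_j(x;t)$ be the monic polynomials orthogonal with respect to $w(\cdot;t)$ on $(0,\infty)$, $h_j(t)=\int_0^\infty P_j(x)^2w(x;t)\,dx$, let $\widehat D_n(t)=\det\bigl(\int_0^\infty x^{j+k}w(x;t)\,dx\bigr)_{0\le j,k\le n-1}$ be the Hankel determinant, and put $$\widehat R_j(t)=\frac{\gamma}{h_j(t)}\int_0^\infty\frac{P_j(x)^2}{x}\,w(x;t)\,dx,\qquad \widehat H_n(t)=t\frac{d}{dt}\ln\frac{\widehat D_n(t)}{\widehat D_n(0)} .$$ (a) Suppose $\beta+\lambda\neq 0$ and define $\widehat y$ by $\widehat R_n(t)=1+\dfrac{1}{\widehat y(t)-1}$. Then for $t>0$ the function $\widehat y$ is well defined, twice continuously differentiable, takes neither of the values $0,1$, and satisfies $$\widehat y''=\frac{(3\widehat y-1)(\widehat y')^2}{2\widehat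 y(\widehat y-1)}-\frac{\widehat y'}{t}+\frac{(\widehat y-1)^2}{2t^2}\Bigl((\beta+\lambda)^2\widehat y-\frac{\gamma^2}{\widehat y}\Bigr)-\frac{(2n+1+\gamma-\beta-\lambda)\widehat y}{t}-\frac{\widehat y(\widehat y+1)}{2(\widehat y-1)} .$$ It has the initial data $$\widehat y(0)=\frac{\gamma}{\beta+\lambda}\quad\text{if }\gamma-\lambda-\beta>0,\qquad \widehat y'(0)=\frac{\gamma(2n+1+\gamma-\beta-\lambda)}{(\beta+\lambda)\bigl((\beta+\lambda-\gamma)^2-1\bigr)}\quad\text{if }\gamma-\lambda-\beta>1,$$ where $\widehat y$ is continuous from the right at $0$ in the first case and $\widehat y'(0)$ is the right derivative in the second. (b) For $t\ge0$ one has $\widehat D_n(t)>0$. For $t>0$ one has $\widehat H_n(t)=-t\sum_{j=0}^{n-1}\widehat R_j(t)$; the function $\widehat H_n$ is twice continuously differentiable there and satisfies $$(t\widehat H_n'')^2=4(n+\widehat H_n')(\widehat H_n-t\widehat H_n')(\widehat H_n'-\gamma)+\bigl((t-\gamma+\beta+\lambda)\widehat H_n'-\widehat H_n-n\gamma\bigr)^2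 .$$ Equivalently, $\sigma(t)=\widehat H_n(t)+nt+n(\beta+\lambda)$ satisfies the Jimbo–Miwa–Okamoto $\sigma$-form of Painlevé V, $$(t\sigma'')^2=\bigl(\sigma-t\sigma'+2(\sigma')^2+(v_0+v_1+v_2+v_3)\sigma'\bigr)^2-4(v_0+\sigma')(v_1+\sigma')(v_2+\sigma')(v_3+\sigma'),$$ with $v_0=0$, $v_1=-n$, $v_2=-\beta-\lambda$, $v_3=-n-\gamma$. Moreover $\widehat H_n(0)=0$, with $\widehat H_n$ continuous from the right at $0$, and if $\gamma-\lambda-\beta>0$ then the right derivative at $0$ is $$\widehat H_n'(0)=\frac{n\gamma}{\beta+\lambda-\gamma}.$$ (c) If $\beta+\lambda\ne0$, then for $t>0$ $$\widehat H_n=\frac{(t\widehat y')^2}{4\widehat y(\widehat y-1)^2}-\frac{\bigl((\beta+\lambda)\widehat y-\gamma\bigr)^2}{4\widehat y}+\frac{t(\beta+\lambda-2n)\widehat y}{2(\widehat y-1)}-\frac{\gamma t}{2(\widehat y-1)}-\frac{t^2\widehat y}{4(\widehat y-1)^2}.$$ -/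

import Mathlib

open Set Filter Topology MeasureTheory

noncomputable section

namespace PerturbedLaguerre

/-- The weight `w(x;t) = (x+t)^{-(λ+β)} x^γ e^{-x-t}` on `(0,∞)`. -/
def weight (lam bet gam t x : ℝ) : ℝ :=
  (x + t) ^ (-(lam + bet)) * x ^ gam * Real.exp (-x - t)

/-- The `n × n` Hankel determinant `det (∫₀^∞ x^{j+k} w(x;t) dx)_{0 ≤ j,k ≤ n-1}`. -/
def hankelDet (lam bet gam : ℝ) (n : ℕ) (t : ℝ) : ℝ :=
  (Matrix.of fun j k : Fin n =>
    ∫ x in Ioi (0 : ℝ), x ^ ((j : ℕ) + (k : ℕ)) * weight lam bet gam t x).det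

/-- The monic orthogonal polynomials `P_n(x;t)` of the weight on `(0,∞)`: the (unnormalized)
Gram–Schmidt process in `L²(w dx)`, applied to the monomials `1, x, x², …`. -/
def monicOP (lam bet gam t : ℝ) (n : ℕ) : Polynomial ℝ :=
  Polynomial.X ^ n - ∑ j : Fin n,
    Polynomial.C
      ((∫ x in Ioi (0 : ℝ), x ^ n * (monicOP lam bet gam t j).eval x * weight lam bet gam t x) /
        (∫ x in Ioi (0 : ℝ), (monicOP lam bet gam t j).eval x ^ 2 * weight lam bet gam t x)) *
      monicOP lam bet gam t j
termination_by n
decreasing_by all_goals exact j.isLt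

/-- `h_n(t) = ∫₀^∞ P_n(x;t)² w(x;t) dx`. -/
def normSq (lam bet gam : ℝ) (n : ℕ) (t : ℝ) : ℝ :=
  ∫ x in Ioi (0 : ℝ), (monicOP lam bet gam t n).eval x ^ 2 * weight lam bet gam t x

/-- `R̂_n(t) = (γ / h_n) ∫₀^∞ P_n(x)² w(x;t) / x dx`. -/
def Rhat (lam bet gam : ℝ) (n : ℕ) (t : ℝ) : ℝ :=
  gam / normSq lam bet gam n t *
    ∫ x in Ioi (0 : ℝ), (monicOP lam bet gam t n).eval x ^ 2 / x * weight lam bet gam t x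

/-- `ŷ`, determined by `R̂_n = 1 + 1 / (ŷ - 1)`. -/
def yhat (lam bet gam : ℝ) (n : ℕ) (t : ℝ) : ℝ :=
  1 + 1 / (Rhat lam bet gam n t - 1)

/-- `Ĥ_n(t) = t (d/dt) ln (D̂_n(t) / D̂_n(0))`. -/
def Hhat (lam bet gam : ℝ) (n : ℕ) (t : ℝ) : ℝ :=
  t * deriv (fun s => Real.log (hankelDet lam bet gam n s / hankelDet lam bet gam n 0)) t

/-- The Jimbo–Miwa–Okamoto `σ`-form of Painlevé V with parameters `v₀, v₁, v₂, v₃`, for a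
function `σ` on `(0,∞)`. -/
def SatisfiesSigmaPV (v₀ v₁ v₂ v₃ : ℝ) (σ : ℝ → ℝ) : Prop :=
  ContDiffOn ℝ 2 σ (Ioi 0) ∧
  ∀ t : ℝ, 0 < t →
    (t * deriv (deriv σ) t) ^ 2 =
      (σ t - t * deriv σ t + 2 * deriv σ t ^ 2 + (v₀ + v₁ + v₂ + v₃) * deriv σ t) ^ 2 -
        4 * (v₀ + deriv σ t) * (v₁ + deriv σ t) * (v₂ + deriv σ t) * (v₃ + deriv σ t)

end PerturbedLaguerre

end

/-! Put `a = λ + β`. The argument is finite-dimensional algebra resting on three linear functionals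
on polynomials: `L`, `N`, `S`, integration against `w`, `w/x` and `w/(x+t)`. They satisfy `N(Xq) =
L(q)`, `S((X+t)q) = L(q)` and, by one integration by parts, `L(q') = a S(q) - γ N(q) + L(q)`
(`IsLaguerreTriple`).

Let `h_n = L(P_n²)`, `p_n` the subleading coefficient of `P_n`, `α_n = p_n - p_{n+1}` and `β_n =
h_n/h_{n-1}` the recurrence coefficients, `R_n = γ N(P_n²)/h_n` and `r_n = γ N(P_n
P_{n-1})/h_{n-1}`. Evaluating the relations on `P_n²` and `P_n P_{n-1}` gives `α_n =
2n+1+γ-a+t(R_n-1)`, `β_n = t(r_n+n) - p_n` and `r_{n+1} + r_n = γ - α_n R_n`. Dividing by `x` or by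
`x+t` creates one simple pole; `IsMonicOrthogonal.pole_identity` at each pole yields a quadratic
relation between `r_n`, `β_n`, `R_n`, `R_{n-1}`, and eliminating `R_{n-1}` gives `recBeta_mul`,
which involves index `n` only.

Differentiating norms and orthogonality in `t` gives `h_n' = -R_n h_n` and `p_n' = r_n + n`. With
the relations above this closes into a first-order system for `(R_n, r_n)`. The Hankel determinant
is `∏ h_j`, so `Ĥ_n = -t ∑ R_j`, which telescopes to `n² + n(γ-a-t) + p_n`; hence `Ĥ_n' = r_n`.
Painlevé V, its σ-form and the formula for `Ĥ_n` in terms of `ŷ` are then algebraic consequences of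
the system.

At `t = 0` the weight is the Laguerre weight `x^(γ-a) e^{-x}`, where `R_n` and `r_n` are explicit.
The system is singular there, and comparing one-sided derivatives in `tR' = F`, `tr' = G` leaves a
linear system for the initial slopes. -/

noncomputable section

namespace PerturbedLaguerre

open Polynomial

/-! ### Moments of the weight and their dependence on `t` -/

/-- The kernel `(x+t)^{-b} x^c e^{-x-t}`. -/
def kernel (b c t x : ℝ) : ℝ := (x + t) ^ (-b) * x ^ c * Real.exp (-x - t)

/-- The integral of `kernel b c t` over `(0,∞)`. -/
def kernelInt (b c t : ℝ) : ℝ := ∫ x in Ioi (0 : ℝ), kernel b c t x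

/-- The parameters for which `kernel b c t` is integrable on `(0,∞)`. -/
def Admissible (b c t : ℝ) : Prop := (0 < t ∧ -1 < c) ∨ (t = 0 ∧ -1 < c - b)

theorem Admissible.nonneg {b c t : ℝ} (h : Admissible b c t) : 0 ≤ t := by
  rcases h with h | h
  · exact h.1.le
  · exact h.1.ge

theorem Admissible.add_nat {b c t : ℝ} (h : Admissible b c t) (k : ℕ) :
    Admissible b (c + k) t := by
  have hk : (0 : ℝ) ≤ k := k.cast_nonneg
  rcases h with h | h
  · exact Or.inl ⟨h.1, by linarith [h.2]⟩
  · exact Or.inr ⟨h.1, by linarith [h.2]⟩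

theorem kernel_pos (b c : ℝ) {t x : ℝ} (ht : 0 ≤ t) (hx : 0 < x) : 0 < kernel b c t x := by
  unfold kernel; positivity

theorem continuousOn_kernel (b c : ℝ) {t : ℝ} (ht : 0 ≤ t) :
    ContinuousOn (kernel b c t) (Ioi 0) := by
  intro x hx
  have hx : 0 < x := hx
  unfold kernel
  refine (ContinuousAt.mul (ContinuousAt.mul ?_ ?_) ?_).continuousWithinAt
  · exact (continuousAt_id.add continuousAt_const).rpow_const (Or.inl (by simp; positivity))
  · exact continuousAt_id.rpow_const (Or.inl hx.ne')
  · fun_prop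

theorem rpow_le_add_rpow (p : ℝ) {u v w : ℝ} (hu : 0 < u) (huv : u ≤ v) (hvw : v ≤ w) :
    v ^ p ≤ u ^ p + w ^ p := by
  have hv := hu.trans_le huv
  have hw := hv.trans_le hvw
  rcases le_total 0 p with hp | hp
  · have := Real.rpow_le_rpow hv.le hvw hp
    have := Real.rpow_nonneg hu.le p
    linarith
  · have := Real.rpow_le_rpow_of_nonpos hu huv hp
    have := Real.rpow_nonneg hw.le p
    linarith

/-- Supplies the dominating function for parameters in `[u, v]`. A real power is monotone in one
direction or the other, so it is bounded by the sum of its endpoint values whatever the sign of `b`;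
the exponentials undo the factor `e^{-t}` at the endpoints. -/
theorem kernel_le (b c : ℝ) {u s v x : ℝ} (hu : 0 ≤ u) (hus : u ≤ s) (hsv : s ≤ v) (hx : 0 < x) :
    kernel b c s x ≤ Real.exp u * kernel b c u x + Real.exp v * kernel b c v x := by
  have h1 := rpow_le_add_rpow (-b) (u := x + u) (v := x + s) (w := x + v) (by positivity)
    (by linarith) (by linarith)
  have h2 : ∀ τ, Real.exp τ * kernel b c τ x = (x + τ) ^ (-b) * (x ^ c * Real.exp (-x)) := by
    intro τ
    unfold kernel
    rw [sub_eq_add_neg, Real.exp_add, Real.exp_neg τ]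
    field_simp
  rw [h2, h2, ← add_mul]
  unfold kernel
  rw [mul_assoc]
  have h3 : 0 < x ^ c := by positivity
  have h4 : Real.exp (-x - s) ≤ Real.exp (-x) := Real.exp_le_exp.2 (by linarith)
  have h5 : 0 ≤ (x + s) ^ (-b) := Real.rpow_nonneg (by linarith) _
  exact mul_le_mul h1 (mul_le_mul_of_nonneg_left h4 h3.le) (by positivity) (h5.trans h1)

theorem integrableOn_kernel {b c t : ℝ} (h : Admissible b c t) :
    IntegrableOn (kernel b c t) (Ioi 0) := by
  rcases h with ⟨ht, hc⟩ | ⟨rfl, hc⟩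
  · have hm := (continuousOn_kernel b c ht.le).aestronglyMeasurable
      (μ := volume) measurableSet_Ioi
    have I1 : IntegrableOn (fun x => Real.exp (-x) * x ^ c) (Ioi 0) := by
      simpa using Real.GammaIntegral_convergent (s := c + 1) (by linarith)
    rcases le_total 0 b with hb | hb
    · refine Integrable.mono' (I1.const_mul (t ^ (-b))) hm ?_
      refine (ae_restrict_iff' measurableSet_Ioi).2 (Eventually.of_forall fun x hx => ?_)
      have hx : 0 < x := hx
      rw [Real.norm_of_nonneg (kernel_pos b c ht.le hx).le]
      unfold kernel
      have h1 : (x + t) ^ (-b) ≤ t ^ (-b) :=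
        Real.rpow_le_rpow_of_nonpos ht (by linarith) (by linarith)
      have h2 : Real.exp (-x - t) ≤ Real.exp (-x) := Real.exp_le_exp.2 (by linarith)
      have h3 : 0 < x ^ c := by positivity
      calc (x + t) ^ (-b) * x ^ c * Real.exp (-x - t) ≤ t ^ (-b) * x ^ c * Real.exp (-x) := by
            gcongr
        _ = _ := by ring
    · have I2 : IntegrableOn (fun x => Real.exp (-x) * x ^ (c - b)) (Ioi 0) := by
        simpa using Real.GammaIntegral_convergent (s := c - b + 1) (by linarith)
      refine Integrable.mono' ((I2.const_mul (2 ^ (-b))).add (I1.const_mul ((2 * t) ^ (-b)))) hm ?_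
      refine (ae_restrict_iff' measurableSet_Ioi).2 (Eventually.of_forall fun x hx => ?_)
      have hx : 0 < x := hx
      rw [Real.norm_of_nonneg (kernel_pos b c ht.le hx).le]
      unfold kernel
      have h1 : (x + t) ^ (-b) ≤ (2 * x) ^ (-b) + (2 * t) ^ (-b) := by
        have hp1 : 0 ≤ (2 * x) ^ (-b) := by positivity
        have hp2 : 0 ≤ (2 * t) ^ (-b) := by positivity
        rcases le_total x t with hxt | hxt
        · have := Real.rpow_le_rpow (z := -b) (by positivity) (show x + t ≤ 2 * t by linarith)
            (by linarith)
          linarith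
        · have := Real.rpow_le_rpow (z := -b) (by positivity) (show x + t ≤ 2 * x by linarith)
            (by linarith)
          linarith
      have h2 : Real.exp (-x - t) ≤ Real.exp (-x) := Real.exp_le_exp.2 (by linarith)
      have h3 : 0 < x ^ c := by positivity
      calc (x + t) ^ (-b) * x ^ c * Real.exp (-x - t)
          ≤ ((2 * x) ^ (-b) + (2 * t) ^ (-b)) * x ^ c * Real.exp (-x) := by
            gcongr
        _ = _ := by
            simp only [Pi.add_apply]
            rw [Real.mul_rpow two_pos.le hx.le, show c - b = c + -b by ring, Real.rpow_add hx]
            ring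
  · have I1 : IntegrableOn (fun x => Real.exp (-x) * x ^ (c - b)) (Ioi 0) := by
      simpa using Real.GammaIntegral_convergent (s := c - b + 1) (by linarith)
    refine I1.congr_fun (fun x hx => ?_) measurableSet_Ioi
    have hx : 0 < x := hx
    simp only [kernel, add_zero, sub_zero]
    rw [show c - b = c + -b by ring, Real.rpow_add hx]
    ring

theorem kernel_add_nat (b c t : ℝ) {x : ℝ} (hx : 0 < x) (k : ℕ) :
    kernel b (c + k) t x = x ^ k * kernel b c t x := by
  unfold kernel
  rw [Real.rpow_add hx, Real.rpow_natCast]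
  ring

theorem kernelInt_shift {b c t : ℝ} (ht : 0 < t) (hc : -1 < c) :
    kernelInt (b + 1) (c + 1) t + t * kernelInt (b + 1) c t = kernelInt b c t := by
  unfold kernelInt
  rw [← integral_const_mul, ← integral_add]
  · refine setIntegral_congr_fun measurableSet_Ioi fun x hx => ?_
    have hx : 0 < x := hx
    have hxt : 0 < x + t := by positivity
    simp only [kernel]
    rw [Real.rpow_add hx, Real.rpow_one, show -b = -(b + 1) + 1 by ring, Real.rpow_add hxt,
      Real.rpow_one]
    ring
  · exact integrableOn_kernel (Or.inl ⟨ht, by linarith⟩)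
  · exact (integrableOn_kernel (Or.inl ⟨ht, hc⟩)).const_mul t

/-- Integrate the derivative of the kernel. The boundary term at `0` vanishes because `c > 0`, the
one at infinity because the kernel and its derivative are both integrable. -/
theorem kernelInt_by_parts {b c t : ℝ} (ht : 0 < t) (hc : 0 < c) :
    c * kernelInt b (c - 1) t = b * kernelInt (b + 1) c t + kernelInt b c t := by
  have hd : ∀ x ∈ Ioi (0 : ℝ), HasDerivAt (kernel b c t)
      (c * kernel b (c - 1) t x - b * kernel (b + 1) c t x - kernel b c t x) x := by
    intro x hx
    have hx : 0 < x := hx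
    have hxt : 0 < x + t := by positivity
    have h1 : HasDerivAt (fun x : ℝ => (x + t) ^ (-b)) (1 * (-b) * (x + t) ^ (-b - 1)) x :=
      ((hasDerivAt_id x).add_const t).rpow_const (Or.inl hxt.ne')
    have h2 : HasDerivAt (fun x : ℝ => x ^ c) (c * x ^ (c - 1)) x :=
      Real.hasDerivAt_rpow_const (Or.inl hx.ne')
    have h3 : HasDerivAt (fun x : ℝ => Real.exp (-x - t)) (Real.exp (-x - t) * (-1)) x :=
      (((hasDerivAt_id x).neg).sub_const t).exp
    refine ((h1.mul h2).mul h3).congr_deriv ?_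
    simp only [kernel, Pi.mul_apply]
    rw [show -(b + 1) = -b - 1 by ring]
    ring
  have i1 := integrableOn_kernel (b := b) (c := c - 1) (t := t) (Or.inl ⟨ht, by linarith⟩)
  have i2 := integrableOn_kernel (b := b + 1) (c := c) (t := t) (Or.inl ⟨ht, by linarith⟩)
  have i3 := integrableOn_kernel (b := b) (c := c) (t := t) (Or.inl ⟨ht, by linarith⟩)
  have hi : IntegrableOn (fun x => c * kernel b (c - 1) t x - b * kernel (b + 1) c t x
      - kernel b c t x) (Ioi 0) := ((i1.const_mul c).sub (i2.const_mul b)).sub i3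
  have hz : kernel b c t 0 = 0 := by simp [kernel, Real.zero_rpow hc.ne']
  have hcont : ContinuousWithinAt (kernel b c t) (Ici 0) 0 := by
    unfold kernel
    refine (ContinuousAt.mul (ContinuousAt.mul ?_ ?_) ?_).continuousWithinAt
    · exact (continuousAt_id.add continuousAt_const).rpow_const (Or.inl (by simp; positivity))
    · exact continuousAt_id.rpow_const (Or.inr hc.le)
    · fun_prop
  have := integral_Ioi_of_hasDerivAt_of_tendsto hcont hd hi
    (tendsto_zero_of_hasDerivAt_of_integrableOn_Ioi hd hi i3)
  have e1 := integral_sub ((i1.const_mul c).sub (i2.const_mul b)) i3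
  have e2 := integral_sub (i1.const_mul c) (i2.const_mul b)
  simp only [Pi.sub_apply, integral_const_mul] at e1 e2
  rw [hz, e1, e2] at this
  unfold kernelInt
  linarith

theorem hasDerivAt_kernelInt {b c t : ℝ} (ht : 0 < t) (hc : -1 < c) :
    HasDerivAt (kernelInt b c) (-kernelInt b c t - b * kernelInt (b + 1) c t) t := by
  have hadm : ∀ {b' τ : ℝ}, 0 < τ → IntegrableOn (kernel b' c τ) (Ioi 0) :=
    fun hτ => integrableOn_kernel (Or.inl ⟨hτ, hc⟩)
  have hs : Ioo (t / 2) (2 * t) ∈ 𝓝 t := Ioo_mem_nhds (by linarith) (by linarith)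
  have key := hasDerivAt_integral_of_dominated_loc_of_deriv_le (μ := volume.restrict (Ioi (0 : ℝ)))
    (F := fun s x => kernel b c s x) (F' := fun s x => -kernel b c s x - b * kernel (b + 1) c s x)
    (bound := fun x => (Real.exp (t / 2) * kernel b c (t / 2) x
        + Real.exp (2 * t) * kernel b c (2 * t) x) +
      |b| * (Real.exp (t / 2) * kernel (b + 1) c (t / 2) x
        + Real.exp (2 * t) * kernel (b + 1) c (2 * t) x)) hs ?_ (hadm ht) ?_ ?_ ?_ ?_
  · have h2 := key.2
    have e1 := integral_sub (hadm (b' := b) ht).neg ((hadm (b' := b + 1) ht).const_mul b)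
    simp only [Pi.neg_apply, integral_neg, integral_const_mul] at e1
    rw [e1] at h2
    exact h2
  · filter_upwards [hs] with s hs
    exact (hadm (by linarith [hs.1])).aestronglyMeasurable
  · exact ((hadm ht).neg.sub ((hadm ht).const_mul b)).aestronglyMeasurable
  · refine (ae_restrict_iff' measurableSet_Ioi).2 (Eventually.of_forall fun x hx s hs => ?_)
    have hx : 0 < x := hx
    have hs0 : 0 ≤ s := by linarith [hs.1]
    have k1 := kernel_le b c (by linarith) hs.1.le hs.2.le hx
    have k2 := kernel_le (b + 1) c (by linarith) hs.1.le hs.2.le hx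
    refine (norm_sub_le _ _).trans (add_le_add ?_ ?_)
    · rw [norm_neg, Real.norm_of_nonneg (kernel_pos b c hs0 hx).le]
      exact k1
    · rw [norm_mul, Real.norm_of_nonneg (kernel_pos (b + 1) c hs0 hx).le, Real.norm_eq_abs]
      gcongr
  · have h1 : 0 < t / 2 := by linarith
    have h2 : 0 < 2 * t := by linarith
    exact (((hadm h1).const_mul _).add ((hadm h2).const_mul _)).add
      ((((hadm h1).const_mul _).add ((hadm h2).const_mul _)).const_mul _)
  · refine (ae_restrict_iff' measurableSet_Ioi).2 (Eventually.of_forall fun x hx s hs => ?_)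
    have hx : 0 < x := hx
    have hs0 : 0 < s := by linarith [hs.1]
    have hxs : 0 < x + s := by positivity
    have h1 : HasDerivAt (fun s : ℝ => (x + s) ^ (-b)) (1 * (-b) * (x + s) ^ (-b - 1)) s :=
      ((hasDerivAt_id s).const_add x).rpow_const (Or.inl hxs.ne')
    have h3 : HasDerivAt (fun s : ℝ => Real.exp (-x - s)) (Real.exp (-x - s) * (-1)) s :=
      ((hasDerivAt_id s).const_sub (-x)).exp
    refine ((h1.mul_const (x ^ c)).mul h3).congr_deriv ?_
    simp only [kernel]
    rw [show -(b + 1) = -b - 1 by ring]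
    ring

theorem continuousWithinAt_kernelInt_zero {b c : ℝ} (hc : -1 < c) (hcb : -1 < c - b) :
    ContinuousWithinAt (kernelInt b c) (Ici 0) 0 := by
  unfold kernelInt
  have hmem : Icc (0 : ℝ) 1 ∈ 𝓝[Ici 0] (0 : ℝ) := Icc_mem_nhdsGE one_pos
  refine continuousWithinAt_of_dominated
    (bound := fun x => Real.exp 0 * kernel b c 0 x + Real.exp 1 * kernel b c 1 x) ?_ ?_ ?_ ?_
  · filter_upwards [hmem] with s hs
    exact (continuousOn_kernel b c hs.1).aestronglyMeasurable measurableSet_Ioi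
  · filter_upwards [hmem] with s hs
    refine (ae_restrict_iff' measurableSet_Ioi).2 (Eventually.of_forall fun x hx => ?_)
    rw [Real.norm_of_nonneg (kernel_pos b c hs.1 hx).le]
    exact kernel_le b c le_rfl hs.1 hs.2 hx
  · exact ((integrableOn_kernel (Or.inr ⟨rfl, hcb⟩)).const_mul _).add
      ((integrableOn_kernel (Or.inl ⟨one_pos, hc⟩)).const_mul _)
  · refine (ae_restrict_iff' measurableSet_Ioi).2 (Eventually.of_forall fun x hx => ?_)
    have hx : 0 < x := hx
    unfold kernel
    refine (ContinuousAt.mul (ContinuousAt.mul ?_ ?_) ?_).continuousWithinAt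
    · exact (continuousAt_const.add continuousAt_id).rpow_const (Or.inl (by simpa using hx.ne'))
    · exact continuousAt_const
    · fun_prop

/-- The formula for the derivative at `t > 0` has a limit at `0`. It contains the exponent `b + 1`,
which is why `c - b` must be larger by one than for continuity. -/
theorem differentiableWithinAt_kernelInt_zero {b c : ℝ} (hc : -1 < c) (hcb : 0 < c - b) :
    DifferentiableWithinAt ℝ (kernelInt b c) (Ici 0) 0 := by
  have h0 := continuousWithinAt_kernelInt_zero (b := b) hc (by linarith)
  have h1 := continuousWithinAt_kernelInt_zero (b := b + 1) hc (by linarith)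
  refine (hasDerivWithinAt_Ici_of_tendsto_deriv (s := Ioi 0)
    (e := -kernelInt b c 0 - b * kernelInt (b + 1) c 0)
    (fun x hx => (hasDerivAt_kernelInt hx hc).differentiableAt.differentiableWithinAt)
    (h0.mono Ioi_subset_Ici_self) self_mem_nhdsWithin ?_).differentiableWithinAt
  have h2 : Tendsto (fun x => -kernelInt b c x - b * kernelInt (b + 1) c x) (𝓝[>] 0)
      (𝓝 (-kernelInt b c 0 - b * kernelInt (b + 1) c 0)) :=
    (h0.mono Ioi_subset_Ici_self).neg.sub
      ((h1.mono Ioi_subset_Ici_self).const_mul b)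
  refine h2.congr' ?_
  filter_upwards [self_mem_nhdsWithin] with x hx
  exact (hasDerivAt_kernelInt hx hc).deriv.symm

theorem contDiffOn_kernelInt {c : ℝ} (hc : -1 < c) (m : ℕ) :
    ∀ b : ℝ, ContDiffOn ℝ m (kernelInt b c) (Ioi 0) := by
  -- The derivative stays in the family with `b` shifted by one, so the induction runs over all `b`
  -- at once.
  induction m with
  | zero =>
    intro b
    exact contDiffOn_zero.2 fun x hx =>
      (hasDerivAt_kernelInt hx hc).continuousAt.continuousWithinAt
  | succ m ih =>
    intro b
    rw [Nat.cast_succ, contDiffOn_succ_iff_deriv_of_isOpen isOpen_Ioi]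
    refine ⟨fun x hx => (hasDerivAt_kernelInt hx hc).differentiableAt.differentiableWithinAt,
      by simp, ?_⟩
    refine ContDiffOn.congr (f := fun x => -kernelInt b c x - b * kernelInt (b + 1) c x)
      ((ih b).neg.sub (contDiffOn_const.mul (ih (b + 1)))) ?_
    intro x hx
    exact (hasDerivAt_kernelInt hx hc).deriv

theorem kernelInt_zero_add_one {b c : ℝ} (h : -1 < c - b) :
    kernelInt b (c + 1) 0 = (c - b + 1) * kernelInt b c 0 := by
  have h1 : ∀ d : ℝ, -1 < d - b → kernelInt b d 0 = Real.Gamma (d - b + 1) := by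
    intro d hd
    rw [Real.Gamma_eq_integral (by linarith)]
    refine setIntegral_congr_fun measurableSet_Ioi fun x hx => ?_
    have hx : 0 < x := hx
    simp only [kernel, add_zero, sub_zero, add_sub_cancel_right]
    rw [show d - b = d + -b by ring, Real.rpow_add hx]
    ring
  rw [h1 _ h, h1 _ (by linarith), show c + 1 - b + 1 = (c - b + 1) + 1 by ring,
    Real.Gamma_add_one (by linarith)]

/-! ### Orthogonal polynomials of a moment functional -/

/-- The linear functional on polynomials with moments `μ`. -/
def momentFunctional (μ : ℕ → ℝ) : ℝ[X] →ₗ[ℝ] ℝ :=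
  Polynomial.lsum fun k => μ k • LinearMap.id

theorem momentFunctional_eq_sum (μ : ℕ → ℝ) {q : ℝ[X]} {N : ℕ} (h : q.natDegree < N) :
    momentFunctional μ q = ∑ k ∈ Finset.range N, q.coeff k * μ k := by
  rw [momentFunctional, Polynomial.lsum_apply, Polynomial.sum_over_range' _ _ N h]
  · simp [mul_comm]
  · simp

theorem momentFunctional_X_pow (μ : ℕ → ℝ) (k : ℕ) : momentFunctional μ (X ^ k) = μ k := by
  rw [momentFunctional, Polynomial.lsum_apply, ← Polynomial.monomial_one_right_eq_X_pow,
    Polynomial.sum_monomial_index] <;> simp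

theorem linearMap_C_mul (L : ℝ[X] →ₗ[ℝ] ℝ) (c : ℝ) (q : ℝ[X]) : L (C c * q) = c * L q := by
  rw [← Polynomial.smul_eq_C_mul, map_smul, smul_eq_mul]

/-- Two linear functionals agreeing on the monomials agree. -/
theorem linearMap_ext_X_pow {L M : ℝ[X] →ₗ[ℝ] ℝ} (h : ∀ k : ℕ, L (X ^ k) = M (X ^ k))
    (q : ℝ[X]) : L q = M q := by
  induction q using Polynomial.induction_on' with
  | add p q hp hq => rw [map_add, map_add, hp, hq]
  | monomial k c => rw [← C_mul_X_pow_eq_monomial, linearMap_C_mul, linearMap_C_mul, h]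

/-- The monic Gram–Schmidt polynomials of the moment functional with moments `μ`. -/
def momentOP (μ : ℕ → ℝ) (n : ℕ) : ℝ[X] :=
  X ^ n - ∑ j : Fin n,
    C (momentFunctional μ (X ^ n * momentOP μ j) / momentFunctional μ (momentOP μ j ^ 2)) *
      momentOP μ j
termination_by n
decreasing_by all_goals exact j.isLt

/-- `P` is the sequence of monic orthogonal polynomials of the functional `L`. -/
structure IsMonicOrthogonal (L : ℝ[X] →ₗ[ℝ] ℝ) (P : ℕ → ℝ[X]) : Prop where
  monic : ∀ n, (P n).Monic
  natDegree_eq : ∀ n, (P n).natDegree = n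
  pos : ∀ n, 0 < L (P n ^ 2)
  orthogonal : ∀ m n, m ≠ n → L (P m * P n) = 0

/-- No positivity is needed: only lower-degree terms are subtracted, even if a quotient takes the
default value of division by zero. Degree bounds therefore hold for every `t`. -/
theorem monic_natDegree_momentOP (μ : ℕ → ℝ) (n : ℕ) :
    (momentOP μ n).Monic ∧ (momentOP μ n).natDegree = n := by
  induction n using Nat.strong_induction_on with
  | _ n ih =>
    have hd : (∑ j : Fin n, C (momentFunctional μ (X ^ n * momentOP μ j) /
        momentFunctional μ (momentOP μ j ^ 2)) * momentOP μ j).degree < n := by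
      refine (Polynomial.degree_sum_le _ _).trans_lt ?_
      refine (Finset.sup_lt_iff (WithBot.bot_lt_coe n)).2 fun j _ => ?_
      rw [← Polynomial.smul_eq_C_mul]
      refine (Polynomial.degree_smul_le _ _).trans_lt ?_
      rw [Polynomial.degree_eq_natDegree (ih j j.isLt).1.ne_zero, (ih j j.isLt).2]
      exact WithBot.coe_lt_coe.2 j.isLt
    rw [momentOP]
    refine ⟨Polynomial.monic_X_pow_sub hd, ?_⟩
    rw [sub_eq_add_neg, Polynomial.natDegree_add_eq_left_of_degree_lt, natDegree_X_pow]
    rwa [Polynomial.degree_neg, Polynomial.degree_X_pow]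

theorem isMonicOrthogonal_momentOP {μ : ℕ → ℝ}
    (hpos : ∀ q : ℝ[X], q ≠ 0 → 0 < momentFunctional μ (q ^ 2)) :
    IsMonicOrthogonal (momentFunctional μ) (momentOP μ) := by
  have hp : ∀ n, 0 < momentFunctional μ (momentOP μ n ^ 2) := fun n =>
    hpos _ (monic_natDegree_momentOP μ n).1.ne_zero
  have key : ∀ n, ∀ m < n, momentFunctional μ (momentOP μ n * momentOP μ m) = 0 := by
    intro n
    induction n using Nat.strong_induction_on with
    | _ n ih =>
      intro m hm
      rw [momentOP, sub_mul, Finset.sum_mul, map_sub, map_sum]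
      rw [Finset.sum_eq_single (⟨m, hm⟩ : Fin n)]
      · rw [mul_assoc, linearMap_C_mul, ← sq, div_mul_cancel₀ _ (hp m).ne', sub_self]
      · intro j _ hj
        have hne : (j : ℕ) ≠ m := fun h => hj (Fin.ext h)
        rw [mul_assoc, linearMap_C_mul]
        rcases lt_or_gt_of_ne hne with h | h
        · rw [mul_comm (momentOP μ j), ih m hm j h, mul_zero]
        · rw [ih j j.isLt m h, mul_zero]
      · simp
  refine ⟨fun n => (monic_natDegree_momentOP μ n).1, fun n => (monic_natDegree_momentOP μ n).2,
    hp, fun m n h => ?_⟩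
  rcases lt_or_gt_of_ne h with h | h
  · rw [mul_comm, key n m h]
  · exact key m n h

theorem coeff_X_mul_derivative (q : ℝ[X]) (k : ℕ) :
    (X * derivative q).coeff k = k * q.coeff k := by
  cases k with
  | zero => simp
  | succ k => rw [coeff_X_mul, coeff_derivative]; push_cast; ring

theorem natDegree_X_mul_derivative_le (q : ℝ[X]) : (X * derivative q).natDegree ≤ q.natDegree :=
  natDegree_le_iff_coeff_eq_zero.2 fun k hk => by
    rw [coeff_X_mul_derivative, coeff_eq_zero_of_natDegree_lt hk, mul_zero]

/-! ### Three-term recurrence and the pole identity -/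

namespace IsMonicOrthogonal

variable {L : ℝ[X] →ₗ[ℝ] ℝ} {P : ℕ → ℝ[X]}

theorem coeff_self (hP : IsMonicOrthogonal L P) (n : ℕ) : (P n).coeff n = 1 := by
  have := hP.monic n
  rwa [Monic, leadingCoeff, hP.natDegree_eq] at this

theorem coeff_eq_zero (hP : IsMonicOrthogonal L P) {n k : ℕ} (h : n < k) : (P n).coeff k = 0 :=
  coeff_eq_zero_of_natDegree_lt (by rwa [hP.natDegree_eq])

theorem coeff_succ (hP : IsMonicOrthogonal L P) (n : ℕ) :
    (P (n + 1)).coeff n = (P (n + 1)).nextCoeff := by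
  rw [nextCoeff_of_natDegree_pos (by rw [hP.natDegree_eq]; omega), hP.natDegree_eq,
    Nat.add_sub_cancel]

theorem nextCoeff_zero (hP : IsMonicOrthogonal L P) : (P 0).nextCoeff = 0 := by
  simp [nextCoeff, hP.natDegree_eq]

theorem eq_one (hP : IsMonicOrthogonal L P) : P 0 = 1 :=
  (hP.monic 0).natDegree_eq_zero.1 (hP.natDegree_eq 0)

theorem coeff_X_mul_self (hP : IsMonicOrthogonal L P) (n : ℕ) :
    (X * P n).coeff n = (P n).nextCoeff := by
  cases n with
  | zero => rw [coeff_X_mul_zero, hP.nextCoeff_zero]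
  | succ n => rw [coeff_X_mul, hP.coeff_succ]

/-- Induction on the degree bound: subtracting the multiple of `P d` with the same top coefficient
lowers the degree. -/
theorem map_mul_of_degree_lt (hP : IsMonicOrthogonal L P) (n : ℕ) :
    ∀ d ≤ n, ∀ q : ℝ[X], q.degree < d → L (P n * q) = 0 := by
  intro d
  induction d with
  | zero =>
    intro _ q hq
    have : q = 0 := by simpa [Polynomial.degree_lt_iff_coeff_zero, Polynomial.ext_iff] using hq
    rw [this, mul_zero, map_zero]
  | succ d ih =>
    intro hd q hq
    rw [Polynomial.degree_lt_iff_coeff_zero] at hq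
    have h1 := ih (by omega) (q - C (q.coeff d) * P d) (by
      rw [Polynomial.degree_lt_iff_coeff_zero]
      intro m hm
      rw [coeff_sub, coeff_C_mul]
      rcases hm.eq_or_lt with rfl | hm
      · rw [hP.coeff_self, mul_one, sub_self]
      · rw [hP.coeff_eq_zero hm, hq m hm, mul_zero, sub_zero])
    rw [mul_sub, map_sub, mul_left_comm, linearMap_C_mul, hP.orthogonal n d (by omega), mul_zero,
      sub_zero] at h1
    exact h1

/-- The workhorse: pairing with `P n` reads off one coefficient. -/
theorem map_mul_of_natDegree_le (hP : IsMonicOrthogonal L P) {n : ℕ} {q : ℝ[X]}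
    (hq : q.natDegree ≤ n) : L (P n * q) = q.coeff n * L (P n ^ 2) := by
  have h1 := hP.map_mul_of_degree_lt n n le_rfl (q - C (q.coeff n) * P n) (by
      rw [Polynomial.degree_lt_iff_coeff_zero]
      intro m hm
      rw [coeff_sub, coeff_C_mul]
      rcases hm.eq_or_lt with rfl | hm
      · rw [hP.coeff_self, mul_one, sub_self]
      · rw [hP.coeff_eq_zero hm, coeff_eq_zero_of_natDegree_lt (hq.trans_lt hm), mul_zero,
          sub_zero])
  rw [mul_sub, map_sub, mul_left_comm, linearMap_C_mul, ← sq] at h1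
  linarith

theorem map_mul_of_natDegree_lt (hP : IsMonicOrthogonal L P) {n : ℕ} {q : ℝ[X]}
    (hq : q.natDegree < n) : L (P n * q) = 0 := by
  rw [hP.map_mul_of_natDegree_le hq.le, coeff_eq_zero_of_natDegree_lt hq, zero_mul]

theorem eq_zero_of_map_mul (hP : IsMonicOrthogonal L P) {q : ℝ[X]}
    (h : ∀ j ≤ q.natDegree, L (P j * q) = 0) : q = 0 := by
  have h1 := h _ le_rfl
  rw [hP.map_mul_of_natDegree_le le_rfl] at h1
  exact leadingCoeff_eq_zero.1 ((mul_eq_zero.1 h1).resolve_right (hP.pos _).ne')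

theorem natDegree_X_mul (hP : IsMonicOrthogonal L P) (n : ℕ) : (X * P n).natDegree = n + 1 := by
  rw [Polynomial.natDegree_X_mul (hP.monic n).ne_zero, hP.natDegree_eq]

theorem natDegree_X_mul_sub_le (hP : IsMonicOrthogonal L P) (n : ℕ) :
    (X * P n - P (n + 1)).natDegree ≤ n := by
  refine natDegree_le_iff_coeff_eq_zero.2 fun k hk => ?_
  rcases (Nat.succ_le_of_lt hk).eq_or_lt with rfl | hk'
  · rw [coeff_sub, Nat.succ_eq_add_one, coeff_X_mul, hP.coeff_self, hP.coeff_self, sub_self]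
  · rw [coeff_sub, hP.coeff_eq_zero hk', coeff_eq_zero_of_natDegree_lt, sub_zero]
    rwa [hP.natDegree_X_mul]

theorem coeff_X_mul_sub (hP : IsMonicOrthogonal L P) (n : ℕ) :
    (X * P n - P (n + 1)).coeff n = (P n).nextCoeff - (P (n + 1)).nextCoeff := by
  rw [coeff_sub, hP.coeff_X_mul_self, hP.coeff_succ]

theorem map_X_mul_sq (hP : IsMonicOrthogonal L P) (n : ℕ) :
    L (X * P n ^ 2) = ((P n).nextCoeff - (P (n + 1)).nextCoeff) * L (P n ^ 2) := by
  rw [← hP.coeff_X_mul_sub, ← hP.map_mul_of_natDegree_le (hP.natDegree_X_mul_sub_le n), mul_sub,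
    map_sub, hP.orthogonal n (n + 1) (by omega), sub_zero]
  congr 1
  ring

theorem map_X_mul_mul_succ (hP : IsMonicOrthogonal L P) (n : ℕ) :
    L (X * (P (n + 1) * P n)) = L (P (n + 1) ^ 2) := by
  rw [show X * (P (n + 1) * P n) = P (n + 1) * (X * P n) by ring,
    hP.map_mul_of_natDegree_le (hP.natDegree_X_mul n).le, coeff_X_mul, hP.coeff_self, one_mul]

theorem map_derivative_X_mul_sq (hP : IsMonicOrthogonal L P) (n : ℕ) :
    L (derivative (X * P n ^ 2)) = (2 * n + 1) * L (P n ^ 2) := by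
  rw [show derivative (X * P n ^ 2) = P n ^ 2 + C 2 * (P n * (X * derivative (P n))) by
    rw [derivative_mul, derivative_sq, derivative_X]; ring, map_add, linearMap_C_mul,
    hP.map_mul_of_natDegree_le
      ((natDegree_X_mul_derivative_le _).trans (hP.natDegree_eq n).le),
    coeff_X_mul_derivative, hP.coeff_self]
  ring

theorem X_mul_zero (hP : IsMonicOrthogonal L P) :
    X * P 0 = P 1 + C ((P 0).nextCoeff - (P 1).nextCoeff) * P 0 := by
  have h : X * P 0 - P 1 = C ((P 0).nextCoeff - (P 1).nextCoeff) := by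
    rw [← hP.coeff_X_mul_sub 0]
    exact eq_C_of_natDegree_le_zero (hP.natDegree_X_mul_sub_le 0)
  rw [hP.eq_one] at h ⊢
  linear_combination h

/-- After subtraction the remainder has degree at most `n`, and moving `X` to the other factor shows
that it is orthogonal to every `P j` with `j ≤ n`; hence it vanishes. -/
theorem X_mul_succ (hP : IsMonicOrthogonal L P) (n : ℕ) :
    X * P (n + 1) = P (n + 2) + C ((P (n + 1)).nextCoeff - (P (n + 2)).nextCoeff) * P (n + 1)
      + C (L (P (n + 1) ^ 2) / L (P n ^ 2)) * P n := by
  set α := (P (n + 1)).nextCoeff - (P (n + 2)).nextCoeff with hα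
  set β := L (P (n + 1) ^ 2) / L (P n ^ 2) with hβ
  have hdeg : (X * P (n + 1) - P (n + 2) - C α * P (n + 1) - C β * P n).natDegree ≤ n := by
    refine natDegree_le_iff_coeff_eq_zero.2 fun k hk => ?_
    rw [coeff_sub, coeff_sub, coeff_C_mul, coeff_C_mul, hP.coeff_eq_zero hk]
    rcases (Nat.succ_le_of_lt hk).eq_or_lt with rfl | hk'
    · rw [Nat.succ_eq_add_one, hP.coeff_X_mul_sub, hP.coeff_self]
      simp [hα]
    · rw [coeff_eq_zero_of_natDegree_lt ((hP.natDegree_X_mul_sub_le (n + 1)).trans_lt hk'),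
        hP.coeff_eq_zero hk']
      simp
  have hz : X * P (n + 1) - P (n + 2) - C α * P (n + 1) - C β * P n = 0 := by
    refine hP.eq_zero_of_map_mul fun j hj => ?_
    have hj := hj.trans hdeg
    rw [mul_sub, mul_sub, mul_sub, map_sub, map_sub, map_sub, hP.orthogonal j (n + 2) (by omega),
      mul_left_comm (P j) (C α), linearMap_C_mul, hP.orthogonal j (n + 1) (by omega),
      mul_left_comm (P j) (C β), linearMap_C_mul,
      show P j * (X * P (n + 1)) = P (n + 1) * (X * P j) by ring,
      hP.map_mul_of_natDegree_le (by rw [hP.natDegree_X_mul]; omega), coeff_X_mul]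
    rcases hj.eq_or_lt with rfl | hj'
    · rw [hP.coeff_self, ← sq, hβ, div_mul_cancel₀ _ (hP.pos j).ne']
      ring
    · rw [hP.coeff_eq_zero hj', hP.orthogonal j n (by omega)]
      ring
  linear_combination hz

/-- If `N` is `L` divided by `X + s`, then `N (P n * q) = q(-s) N (P n)` when `deg q ≤ n`. -/
theorem map_pole_mul (hP : IsMonicOrthogonal L P) {N : ℝ[X] →ₗ[ℝ] ℝ} {s : ℝ}
    (hN : ∀ q, N ((X + C s) * q) = L q) {n : ℕ} {q : ℝ[X]} (hq : q.natDegree ≤ n) :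
    N (P n * q) = q.eval (-s) * N (P n) := by
  have h1 : C (q.eval (-s)) + (X + C s) * (q /ₘ (X - C (-s))) = q := by
    have := modByMonic_add_div q (X - C (-s))
    rw [modByMonic_X_sub_C_eq_C_eval] at this
    simpa using this
  have h2 : L (P n * (q /ₘ (X - C (-s)))) = 0 := by
    have hd : (q /ₘ (X - C (-s))).natDegree = q.natDegree - 1 := by
      rw [natDegree_divByMonic _ (monic_X_sub_C _), natDegree_X_sub_C]
    cases n with
    | zero =>
      rw [eq_C_of_natDegree_le_zero hq, (divByMonic_eq_zero_iff (monic_X_sub_C _)).2, mul_zero,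
        map_zero]
      rw [degree_X_sub_C]
      exact degree_C_lt
    | succ n => exact hP.map_mul_of_natDegree_lt (by omega)
  calc N (P n * q) = N (C (q.eval (-s)) * P n + (X + C s) * (P n * (q /ₘ (X - C (-s))))) := by
        congr 1
        nth_rewrite 1 [← h1]
        ring
    _ = _ := by rw [map_add, hN, h2, linearMap_C_mul, add_zero]

/-- By `map_pole_mul` the first factor is `P_n(-s) N(P_{n+1})`. The second is `N(P_n (P_{n+1} -
(X+s) P_n))`, where the leading terms cancel and evaluation at `-s` kills the subtracted part,
leaving `P_{n+1}(-s) N(P_n)`. Regrouping gives the right side. -/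
theorem pole_identity (hP : IsMonicOrthogonal L P) {N : ℝ[X] →ₗ[ℝ] ℝ} {s : ℝ}
    (hN : ∀ q, N ((X + C s) * q) = L q) (n : ℕ) :
    N (P (n + 1) * P n) * (N (P (n + 1) * P n) - L (P n ^ 2)) =
      N (P (n + 1) ^ 2) * N (P n ^ 2) := by
  have h1 := hP.map_pole_mul hN (n := n + 1) (q := P n) (by rw [hP.natDegree_eq]; omega)
  have h2 := hP.map_pole_mul hN (n := n + 1) (q := P (n + 1)) (by rw [hP.natDegree_eq])
  have h3 := hP.map_pole_mul hN (n := n) (q := P n) (by rw [hP.natDegree_eq])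
  have hd : (P (n + 1) - (X + C s) * P n).natDegree ≤ n := by
    refine natDegree_le_iff_coeff_eq_zero.2 fun k hk => ?_
    have h := hP.natDegree_X_mul_sub_le n
    rw [natDegree_le_iff_coeff_eq_zero] at h
    have := h k hk
    rw [coeff_sub] at this
    rw [coeff_sub, add_mul, coeff_add, coeff_C_mul, hP.coeff_eq_zero hk]
    linarith
  have h4 := hP.map_pole_mul hN hd
  have e1 : N (P n * (P (n + 1) - (X + C s) * P n)) = N (P (n + 1) * P n) - L (P n ^ 2) := by
    rw [← hN, ← map_sub]
    congr 1
    ring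
  rw [e1] at h4
  simp only [eval_sub, eval_mul, eval_add, eval_X, eval_C, neg_add_cancel, zero_mul,
    sub_zero] at h4
  rw [h4, sq, sq, h2, h3, h1]
  ring

end IsMonicOrthogonal

/-! ### Ladder quantities and their difference relations -/

/-- The relations between integration against `w`, `w / x` and `w / (x + t)`, where
`w = (x+t)^{-a} x^γ e^{-x-t}`. -/
structure IsLaguerreTriple (a gam t : ℝ) (L N S : ℝ[X] →ₗ[ℝ] ℝ) : Prop where
  map_X_mul : ∀ q, N (X * q) = L q
  map_X_add_mul : ∀ q, S ((X + C t) * q) = L q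
  map_derivative : ∀ q, L (derivative q) = a * S q - gam * N q + L q

/-- `γ N(P_n²) / L(P_n²)` -/
def ladderR (gam : ℝ) (L N : ℝ[X] →ₗ[ℝ] ℝ) (P : ℕ → ℝ[X]) (n : ℕ) : ℝ :=
  gam * N (P n ^ 2) / L (P n ^ 2)

/-- `γ N(P_n P_{n-1}) / L(P_{n-1}²)` -/
def ladderS (gam : ℝ) (L N : ℝ[X] →ₗ[ℝ] ℝ) (P : ℕ → ℝ[X]) : ℕ → ℝ
  | 0 => 0
  | n + 1 => gam * N (P (n + 1) * P n) / L (P n ^ 2)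

/-- `L(P_n²) / L(P_{n-1}²)` -/
def recBeta (L : ℝ[X] →ₗ[ℝ] ℝ) (P : ℕ → ℝ[X]) : ℕ → ℝ
  | 0 => 0
  | n + 1 => L (P (n + 1) ^ 2) / L (P n ^ 2)

namespace IsLaguerreTriple

variable {a gam t : ℝ} {L N S : ℝ[X] →ₗ[ℝ] ℝ} {P : ℕ → ℝ[X]}

theorem map_derivative_X_mul (h : IsLaguerreTriple a gam t L N S) (q : ℝ[X]) :
    L (derivative (X * q)) = (a - gam) * L q - t * (a * S q) + L (X * q) := by
  have h1 : S (X * q) = L q - t * S q := by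
    have := h.map_X_add_mul q
    rw [add_mul, map_add, linearMap_C_mul] at this
    linarith
  rw [h.map_derivative, h1, h.map_X_mul]
  ring

/-- `L((P_n²)') = 0` by degree, so integration by parts expresses the pole at `-t` through the pole
at `0`; no second family of ladder quantities is needed. -/
theorem map_S_sq (h : IsLaguerreTriple a gam t L N S) (hP : IsMonicOrthogonal L P) (n : ℕ) :
    a * S (P n ^ 2) = (ladderR gam L N P n - 1) * L (P n ^ 2) := by
  have h1 := h.map_derivative (P n ^ 2)
  have h2 : L (derivative (P n ^ 2)) = 0 := by
    rw [show derivative (P n ^ 2) = C 2 * (P n * derivative (P n)) by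
      rw [derivative_sq, mul_assoc], linearMap_C_mul, mul_eq_zero]
    right
    cases n with
    | zero => rw [hP.eq_one]; simp
    | succ n =>
      refine hP.map_mul_of_natDegree_lt ((natDegree_derivative_lt ?_).trans_le ?_) <;>
        rw [hP.natDegree_eq]
      omega
  have := (hP.pos n).ne'
  rw [ladderR]
  field_simp
  linarith

theorem map_derivative_mul_succ (hP : IsMonicOrthogonal L P) (n : ℕ) :
    L (derivative (P (n + 1) * P n)) = (n + 1) * L (P n ^ 2) := by
  rw [derivative_mul, map_add, mul_comm (derivative _), hP.map_mul_of_natDegree_le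
    (by have := natDegree_derivative_le (P (n + 1)); rw [hP.natDegree_eq] at this; exact this),
    coeff_derivative, hP.coeff_self, hP.map_mul_of_natDegree_lt, add_zero, one_mul]
  have := natDegree_derivative_le (P n)
  rw [hP.natDegree_eq] at this
  omega

theorem map_S_mul_succ (h : IsLaguerreTriple a gam t L N S) (hP : IsMonicOrthogonal L P) (n : ℕ) :
    a * S (P (n + 1) * P n) = (ladderS gam L N P (n + 1) + (n + 1)) * L (P n ^ 2) := by
  have h1 := h.map_derivative (P (n + 1) * P n)
  rw [map_derivative_mul_succ hP, hP.orthogonal (n + 1) n (by omega)] at h1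
  have := (hP.pos n).ne'
  rw [ladderS]
  field_simp
  linarith

theorem recAlpha_eq (h : IsLaguerreTriple a gam t L N S) (hP : IsMonicOrthogonal L P) (n : ℕ) :
    (P n).nextCoeff - (P (n + 1)).nextCoeff =
      2 * n + 1 + gam - a + t * (ladderR gam L N P n - 1) := by
  have h1 := h.map_derivative_X_mul (P n ^ 2)
  rw [h.map_S_sq hP, hP.map_X_mul_sq] at h1
  rw [hP.map_derivative_X_mul_sq] at h1
  refine mul_right_cancel₀ (hP.pos n).ne' ?_
  linarith

theorem recBeta_eq (h : IsLaguerreTriple a gam t L N S) (hP : IsMonicOrthogonal L P) (n : ℕ) :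
    recBeta L P n = t * (ladderS gam L N P n + n) - (P n).nextCoeff := by
  cases n with
  | zero => simp [recBeta, ladderS, hP.nextCoeff_zero]
  | succ n =>
    have h1 := h.map_derivative_X_mul (P (n + 1) * P n)
    rw [h.map_S_mul_succ hP, hP.map_X_mul_mul_succ, hP.orthogonal (n + 1) n (by omega)] at h1
    -- Subtracting `(n+1) P_{n+1}` cancels the leading term and leaves `-p_{n+1}` as coefficient of
    -- `X^n`, which pairing with `P n` extracts.
    have hd : (X * derivative (P (n + 1)) - C ((n : ℝ) + 1) * P (n + 1)).natDegree ≤ n := by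
      refine natDegree_le_iff_coeff_eq_zero.2 fun k hk => ?_
      rw [coeff_sub, coeff_X_mul_derivative, coeff_C_mul]
      rcases (Nat.succ_le_of_lt hk).eq_or_lt with rfl | hk'
      · push_cast; ring
      · rw [hP.coeff_eq_zero hk']; ring
    have h2 : L (derivative (X * (P (n + 1) * P n))) =
        -(P (n + 1)).nextCoeff * L (P n ^ 2) := by
      rw [show derivative (X * (P (n + 1) * P n)) =
        C ((n : ℝ) + 2) * (P (n + 1) * P n) +
          P n * (X * derivative (P (n + 1)) - C ((n : ℝ) + 1) * P (n + 1)) +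
          P (n + 1) * (X * derivative (P n)) by
        rw [derivative_mul, derivative_mul, derivative_X]
        simp only [C_add, C_1, show C (2 : ℝ) = 2 from rfl]
        ring, map_add, map_add, linearMap_C_mul, hP.orthogonal (n + 1) n (by omega),
        hP.map_mul_of_natDegree_le hd, hP.map_mul_of_natDegree_lt
          ((natDegree_X_mul_derivative_le _).trans_lt (by rw [hP.natDegree_eq]; omega)),
        coeff_sub, coeff_X_mul_derivative, coeff_C_mul, hP.coeff_succ]
      ring
    rw [h2] at h1
    have := (hP.pos n).ne'
    rw [recBeta, div_eq_iff this]
    push_cast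
    linarith

/-- Expand `X P_n` by the recurrence in `N(X P_n²) = L(P_n²)`. -/
theorem ladderS_add (h : IsLaguerreTriple a gam t L N S) (hP : IsMonicOrthogonal L P) (n : ℕ) :
    ladderS gam L N P (n + 1) + ladderS gam L N P n =
      gam - ((P n).nextCoeff - (P (n + 1)).nextCoeff) * ladderR gam L N P n := by
  have h1 := h.map_X_mul (P n ^ 2)
  have hn := (hP.pos n).ne'
  cases n with
  | zero =>
    rw [show X * P 0 ^ 2 = P 0 * (X * P 0) by ring, hP.X_mul_zero,
      show ∀ c, P 0 * (P 1 + C c * P 0) = P (0 + 1) * P 0 + C c * P 0 ^ 2 by intro c; ring,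
      map_add, linearMap_C_mul] at h1
    simp only [ladderS, ladderR]
    field_simp
    linear_combination gam * h1
  | succ n =>
    have hn' := (hP.pos n).ne'
    rw [show X * P (n + 1) ^ 2 = P (n + 1) * (X * P (n + 1)) by ring, hP.X_mul_succ,
      show ∀ c d, P (n + 1) * (P (n + 2) + C c * P (n + 1) + C d * P n) =
        P (n + 1 + 1) * P (n + 1) + C c * P (n + 1) ^ 2 + C d * (P (n + 1) * P n) by
          intro c d; ring,
      map_add, map_add, linearMap_C_mul, linearMap_C_mul] at h1
    simp only [ladderS, ladderR]
    field_simp at h1 ⊢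
    linear_combination gam * h1

theorem ladder_pole_zero (h : IsLaguerreTriple a gam t L N S) (hP : IsMonicOrthogonal L P)
    (n : ℕ) :
    ladderS gam L N P (n + 1) ^ 2 - gam * ladderS gam L N P (n + 1) =
      recBeta L P (n + 1) * ladderR gam L N P (n + 1) * ladderR gam L N P n := by
  have h1 := hP.pole_identity (N := N) (s := 0) (by simpa using h.map_X_mul) n
  have h2 := (hP.pos n).ne'
  have h3 := (hP.pos (n + 1)).ne'
  simp only [ladderS, ladderR, recBeta]
  field_simp
  linear_combination gam ^ 2 * h1

theorem ladder_pole_neg (h : IsLaguerreTriple a gam t L N S) (hP : IsMonicOrthogonal L P)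
    (n : ℕ) :
    (ladderS gam L N P (n + 1) + (n + 1)) ^ 2 - a * (ladderS gam L N P (n + 1) + (n + 1)) =
      recBeta L P (n + 1) * (ladderR gam L N P (n + 1) - 1) * (ladderR gam L N P n - 1) := by
  have h1 := hP.pole_identity (N := S) (s := t) h.map_X_add_mul n
  have h2 := (hP.pos n).ne'
  have h3 := (hP.pos (n + 1)).ne'
  have e1 := h.map_S_mul_succ hP n
  have e2 := h.map_S_sq hP n
  have e3 := h.map_S_sq hP (n + 1)
  rw [eq_comm, ← eq_div_iff h2] at e1 e2
  rw [eq_comm, ← eq_div_iff h3] at e3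
  rw [e1, e2, e3, recBeta]
  field_simp
  linear_combination a ^ 2 * h1

/-- The first-order system satisfied by the ladder quantities, cleared of the index `n - 1`. -/
theorem recBeta_mul (h : IsLaguerreTriple a gam t L N S) (hP : IsMonicOrthogonal L P) (n : ℕ) :
    recBeta L P n * ladderR gam L N P n * (ladderR gam L N P n - 1) =
      -(ladderS gam L N P n ^ 2 - gam * ladderS gam L N P n) + ladderR gam L N P n *
        ((a - gam - 2 * n) * ladderS gam L N P n + n * (a - n)) := by
  cases n with
  | zero => simp [recBeta, ladderS]
  | succ n =>
    have h1 := h.ladder_pole_zero hP n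
    have h2 := h.ladder_pole_neg hP n
    push_cast
    -- With these weights the terms in `R_n` cancel on the right, leaving `-β_{n+1} R_{n+1} (R_{n+1}
    -- - 1)`.
    linear_combination (1 - ladderR gam L N P (n + 1)) * h1 + ladderR gam L N P (n + 1) * h2

/-- The sum telescopes, since `t R_j` is `p_j - p_{j+1}` plus an explicit term. -/
theorem sum_ladderR (h : IsLaguerreTriple a gam t L N S) (hP : IsMonicOrthogonal L P) (n : ℕ) :
    -(t * ∑ j ∈ Finset.range n, ladderR gam L N P j) =
      n ^ 2 + n * (gam - a - t) + (P n).nextCoeff := by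
  induction n with
  | zero => simp [hP.nextCoeff_zero]
  | succ n ih =>
    have := h.recAlpha_eq hP n
    rw [Finset.sum_range_succ]
    push_cast
    linear_combination ih + this

end IsLaguerreTriple

/-! ### The concrete weight and its Hankel determinant -/

/-- Integration of polynomials against `kernel b c t`. -/
def polyInt (b c t : ℝ) : ℝ[X] →ₗ[ℝ] ℝ := momentFunctional fun k => kernelInt b (c + k) t

theorem polyInt_X_pow (b c t : ℝ) (k : ℕ) : polyInt b c t (X ^ k) = kernelInt b (c + k) t :=
  momentFunctional_X_pow _ k

theorem eval_mul_kernel_eq_sum (b c t : ℝ) (q : ℝ[X]) {x : ℝ} (hx : 0 < x) :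
    q.eval x * kernel b c t x =
      ∑ k ∈ Finset.range (q.natDegree + 1), q.coeff k * kernel b (c + k) t x := by
  rw [eval_eq_sum_range, Finset.sum_mul]
  refine Finset.sum_congr rfl fun k _ => ?_
  rw [kernel_add_nat b c t hx]
  ring

theorem integrableOn_eval_mul_kernel {b c t : ℝ} (h : Admissible b c t) (q : ℝ[X]) :
    IntegrableOn (fun x => q.eval x * kernel b c t x) (Ioi 0) := by
  refine IntegrableOn.congr_fun (f := fun x =>
    ∑ k ∈ Finset.range (q.natDegree + 1), q.coeff k * kernel b (c + k) t x) ?_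
    (fun x hx => (eval_mul_kernel_eq_sum b c t q hx).symm) measurableSet_Ioi
  exact integrable_finsetSum _ fun k _ => (integrableOn_kernel (h.add_nat k)).const_mul _

theorem integral_eval_mul_kernel {b c t : ℝ} (h : Admissible b c t) (q : ℝ[X]) :
    ∫ x in Ioi (0 : ℝ), q.eval x * kernel b c t x = polyInt b c t q := by
  rw [setIntegral_congr_fun measurableSet_Ioi
      (fun x hx => eval_mul_kernel_eq_sum b c t q hx), integral_finsetSum _
      fun k _ => (integrableOn_kernel (h.add_nat k)).const_mul _,
    polyInt, momentFunctional_eq_sum _ (Nat.lt_succ_self _)]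
  refine Finset.sum_congr rfl fun k _ => ?_
  rw [integral_const_mul, kernelInt]

theorem polyInt_sq_pos {b c t : ℝ} (h : Admissible b c t) {q : ℝ[X]} (hq : q ≠ 0) :
    0 < polyInt b c t (q ^ 2) := by
  have hnn : ∀ x ∈ Ioi (0 : ℝ), 0 ≤ (q ^ 2).eval x * kernel b c t x := fun x hx => by
    rw [eval_pow]
    exact mul_nonneg (sq_nonneg _) (kernel_pos b c h.nonneg hx).le
  rw [← integral_eval_mul_kernel h, setIntegral_pos_iff_support_of_nonneg_ae
    ((ae_restrict_iff' measurableSet_Ioi).2 (Eventually.of_forall hnn))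
    (integrableOn_eval_mul_kernel h _)]
  -- The integrand is nonzero off the finite, hence null, set of roots.
  have hsub : Ioi (0 : ℝ) \ (q.roots.toFinset : Set ℝ) ⊆
      Function.support (fun x => (q ^ 2).eval x * kernel b c t x) ∩ Ioi 0 := by
    rintro x ⟨hx, hr⟩
    refine ⟨?_, hx⟩
    have hr' : q.eval x ≠ 0 := fun h0 => hr (by simp [hq, h0])
    rw [Function.mem_support, eval_pow]
    exact mul_ne_zero (pow_ne_zero 2 hr') (kernel_pos b c h.nonneg hx).ne'
  refine lt_of_lt_of_le ?_ (measure_mono hsub)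
  rw [measure_sdiff_null (Set.Finite.measure_zero (Finset.finite_toSet _) _)]
  simp

/-- The monic orthogonal polynomials of `kernel a gam t`. -/
def kernelOP (a gam t : ℝ) (n : ℕ) : ℝ[X] := momentOP (fun k => kernelInt a (gam + k) t) n

theorem isMonicOrthogonal_kernelOP {a gam t : ℝ} (h : Admissible a gam t) :
    IsMonicOrthogonal (polyInt a gam t) (kernelOP a gam t) :=
  isMonicOrthogonal_momentOP fun _ hq => polyInt_sq_pos h hq

theorem integral_eval_mul_weight {lam bet gam t : ℝ} (h : Admissible (lam + bet) gam t)
    (q : ℝ[X]) :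
    ∫ x in Ioi (0 : ℝ), q.eval x * weight lam bet gam t x = polyInt (lam + bet) gam t q :=
  integral_eval_mul_kernel h q

theorem monicOP_eq_kernelOP {lam bet gam t : ℝ} (h : Admissible (lam + bet) gam t) (n : ℕ) :
    monicOP lam bet gam t n = kernelOP (lam + bet) gam t n := by
  induction n using Nat.strong_induction_on with
  | _ n ih =>
    rw [monicOP, kernelOP, momentOP]
    congr 1
    refine Finset.sum_congr rfl fun j _ => ?_
    rw [ih j j.isLt]
    have h1 := integral_eval_mul_weight h (X ^ n * kernelOP (lam + bet) gam t j)
    have h2 := integral_eval_mul_weight h (kernelOP (lam + bet) gam t j ^ 2)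
    simp only [eval_mul, eval_pow, eval_X] at h1 h2
    rw [h1, h2]
    rfl

theorem normSq_eq_polyInt {lam bet gam t : ℝ} (h : Admissible (lam + bet) gam t) (n : ℕ) :
    normSq lam bet gam n t = polyInt (lam + bet) gam t (kernelOP (lam + bet) gam t n ^ 2) := by
  rw [normSq, ← integral_eval_mul_weight h, monicOP_eq_kernelOP h]
  simp only [eval_pow]

theorem Rhat_eq_ladderR {lam bet gam t : ℝ} (h : Admissible (lam + bet) gam t)
    (h' : Admissible (lam + bet) (gam - 1) t) (n : ℕ) :
    Rhat lam bet gam n t = ladderR gam (polyInt (lam + bet) gam t)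
      (polyInt (lam + bet) (gam - 1) t) (kernelOP (lam + bet) gam t) n := by
  rw [Rhat, ladderR, normSq_eq_polyInt h, ← integral_eval_mul_kernel h', mul_div_right_comm,
    monicOP_eq_kernelOP h]
  congr 1
  refine setIntegral_congr_fun measurableSet_Ioi fun x hx => ?_
  have hx : 0 < x := hx
  simp only [eval_pow, weight, kernel]
  rw [Real.rpow_sub_one hx.ne']
  ring

/-- The unipotent lower-triangular matrix of coefficients of the `P_j` conjugates the Hankel matrix,
as a Gram matrix, to the diagonal one of squared norms. -/
theorem hankelDet_eq_prod {lam bet gam t : ℝ} (h : Admissible (lam + bet) gam t) (n : ℕ) :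
    hankelDet lam bet gam n t = ∏ j ∈ Finset.range n,
      polyInt (lam + bet) gam t (kernelOP (lam + bet) gam t j ^ 2) := by
  have hP := isMonicOrthogonal_kernelOP h
  set L := polyInt (lam + bet) gam t
  set P := kernelOP (lam + bet) gam t
  set M : Matrix (Fin n) (Fin n) ℝ := Matrix.of fun j k => L (X ^ ((j : ℕ) + (k : ℕ))) with hM
  set T : Matrix (Fin n) (Fin n) ℝ := Matrix.of fun j k => (P j).coeff k with hT
  have hD : hankelDet lam bet gam n t = M.det := by
    rw [hankelDet]
    congr 1
    ext j k
    simp only [Matrix.of_apply, hM]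
    rw [← integral_eval_mul_weight h]
    simp only [eval_pow, eval_X]
  have hTdet : T.det = 1 := by
    rw [Matrix.det_of_isLowerTriangular]
    · exact Finset.prod_eq_one fun i _ => by simp [hT, hP.coeff_self]
    · intro i j hij
      exact hP.coeff_eq_zero (by simpa using hij)
  have hsum : ∀ j : Fin n, P j = ∑ k : Fin n, C ((P j).coeff k) * X ^ (k : ℕ) := by
    intro j
    rw [Fin.sum_univ_eq_sum_range (fun k => C ((P j).coeff k) * X ^ k)]
    exact as_sum_range_C_mul_X_pow' _ (by rw [hP.natDegree_eq]; exact j.isLt)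
  have hdiag : T * M * T.transpose = Matrix.diagonal fun j : Fin n => L (P j ^ 2) := by
    ext i j
    have e : (T * M * T.transpose) i j = L (P i * P j) := by
      rw [hsum i, hsum j, Finset.sum_mul_sum, map_sum]
      simp only [Matrix.mul_apply, Matrix.transpose_apply, hT, hM, Matrix.of_apply,
        Finset.sum_mul, map_sum]
      rw [Finset.sum_comm]
      refine Finset.sum_congr rfl fun k _ => Finset.sum_congr rfl fun l _ => ?_
      rw [show ∀ c d : ℝ, C c * (X : ℝ[X]) ^ (k : ℕ) * (C d * X ^ (l : ℕ)) =
        C c * (C d * X ^ ((k : ℕ) + (l : ℕ))) by intro c d; ring, linearMap_C_mul,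
        linearMap_C_mul]
      ring
    rw [e, Matrix.diagonal_apply]
    split_ifs with hij
    · rw [hij, sq]
    · exact hP.orthogonal _ _ fun h' => hij (Fin.ext h')
  have hdet := congrArg Matrix.det hdiag
  rw [Matrix.det_mul, Matrix.det_mul, Matrix.det_transpose, hTdet, Matrix.det_diagonal, one_mul,
    mul_one] at hdet
  rw [hD, hdet, Fin.prod_univ_eq_prod_range (fun j => L (P j ^ 2))]

/-- Checked on monomials. Integration by parts with exponent `γ + k` is available down to `k = 0`
because `γ > 0`. -/
theorem isLaguerreTriple {a gam t : ℝ} (ht : 0 < t) (hgam : 0 < gam) :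
    IsLaguerreTriple a gam t (polyInt a gam t) (polyInt a (gam - 1) t)
      (polyInt (a + 1) gam t) := by
  refine ⟨fun q => ?_, fun q => ?_, fun q => ?_⟩
  · refine linearMap_ext_X_pow
      (L := polyInt a (gam - 1) t ∘ₗ LinearMap.mulLeft ℝ X) (fun k => ?_) q
    rw [LinearMap.comp_apply, LinearMap.mulLeft_apply, ← pow_succ', polyInt_X_pow, polyInt_X_pow]
    congr 1
    push_cast
    ring
  · refine linearMap_ext_X_pow
      (L := polyInt (a + 1) gam t ∘ₗ LinearMap.mulLeft ℝ (X + C t)) (fun k => ?_) q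
    have hk : (0 : ℝ) ≤ k := k.cast_nonneg
    rw [LinearMap.comp_apply, LinearMap.mulLeft_apply, add_mul, map_add, linearMap_C_mul,
      ← pow_succ', polyInt_X_pow, polyInt_X_pow, polyInt_X_pow,
      ← kernelInt_shift (b := a) (c := gam + k) ht (by linarith)]
    push_cast
    rw [add_assoc]
  · refine linearMap_ext_X_pow (L := polyInt a gam t ∘ₗ derivative)
      (M := a • polyInt (a + 1) gam t - gam • polyInt a (gam - 1) t + polyInt a gam t)
      (fun k => ?_) q
    have hk : (0 : ℝ) ≤ k := k.cast_nonneg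
    have h1 := kernelInt_by_parts (b := a) (c := gam + k) ht (by linarith)
    have h2 : polyInt a gam t (derivative (X ^ k)) = k * kernelInt a (gam + k - 1) t := by
      rw [derivative_X_pow, linearMap_C_mul, polyInt_X_pow]
      cases k with
      | zero => simp
      | succ k => congr 2; push_cast; ring
    simp only [LinearMap.comp_apply, LinearMap.add_apply, LinearMap.sub_apply,
      LinearMap.smul_apply, smul_eq_mul, polyInt_X_pow]
    rw [h2, show gam - 1 + (k : ℝ) = gam + k - 1 by ring]
    linarith

/-! ### Regularity in `t` -/

/-- A class of real functions, such as those regular at `t₀`, that is closed under the field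
operations, division being restricted to denominators not vanishing at `t₀`. -/
structure IsFieldClosed (t₀ : ℝ) (Φ : (ℝ → ℝ) → Prop) : Prop where
  const : ∀ c, Φ fun _ => c
  add : ∀ f g, Φ f → Φ g → Φ fun t => f t + g t
  mul : ∀ f g, Φ f → Φ g → Φ fun t => f t * g t
  div : ∀ f g, Φ f → Φ g → g t₀ ≠ 0 → Φ fun t => f t / g t

namespace IsFieldClosed

variable {t₀ : ℝ} {Φ : (ℝ → ℝ) → Prop}

theorem sum (hΦ : IsFieldClosed t₀ Φ) {ι : Type*} (s : Finset ι) (f : ι → ℝ → ℝ)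
    (h : ∀ i ∈ s, Φ (f i)) : Φ fun t => ∑ i ∈ s, f i t := by
  classical
  induction s using Finset.induction_on with
  | empty => simpa using hΦ.const 0
  | insert i s hi ih =>
    simp only [Finset.sum_insert hi]
    exact hΦ.add _ _ (h i (Finset.mem_insert_self i s))
      (ih fun j hj => h j (Finset.mem_insert_of_mem hj))

theorem coeff_mul (hΦ : IsFieldClosed t₀ Φ) {p q : ℝ → ℝ[X]} (hp : ∀ k, Φ fun t => (p t).coeff k)
    (hq : ∀ k, Φ fun t => (q t).coeff k) (k : ℕ) : Φ fun t => (p t * q t).coeff k := by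
  simp only [Polynomial.coeff_mul]
  exact hΦ.sum _ _ fun i _ => hΦ.mul _ _ (hp i.1) (hq i.2)

theorem momentFunctional (hΦ : IsFieldClosed t₀ Φ) {μ : ℝ → ℕ → ℝ} (hμ : ∀ k, Φ fun t => μ t k)
    {q : ℝ → ℝ[X]} (hq : ∀ k, Φ fun t => (q t).coeff k) {N : ℕ} (hN : ∀ t, (q t).natDegree ≤ N) :
    Φ fun t => momentFunctional (μ t) (q t) := by
  simp only [fun t => momentFunctional_eq_sum (μ t) (Nat.lt_succ_of_le (hN t))]
  exact hΦ.sum _ _ fun k _ => hΦ.mul _ _ (hq k) (hμ k)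

theorem momentFunctional_mul (hΦ : IsFieldClosed t₀ Φ) {μ : ℝ → ℕ → ℝ}
    (hμ : ∀ k, Φ fun t => μ t k) {p q : ℝ → ℝ[X]} (hp : ∀ k, Φ fun t => (p t).coeff k)
    (hq : ∀ k, Φ fun t => (q t).coeff k) {M N : ℕ} (hM : ∀ t, (p t).natDegree ≤ M)
    (hN : ∀ t, (q t).natDegree ≤ N) :
    Φ fun t => PerturbedLaguerre.momentFunctional (μ t) (p t * q t) :=
  hΦ.momentFunctional hμ (hΦ.coeff_mul hp hq)
    fun t => natDegree_mul_le.trans (add_le_add (hM t) (hN t))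

/-- The coefficients are rational in the moments and the denominators are squared norms, so one
argument covers continuity, one-sided differentiability and smoothness. -/
theorem coeff_momentOP (hΦ : IsFieldClosed t₀ Φ) {μ : ℝ → ℕ → ℝ} (hμ : ∀ k, Φ fun t => μ t k)
    (hpos : IsMonicOrthogonal (PerturbedLaguerre.momentFunctional (μ t₀)) (momentOP (μ t₀)))
    (n : ℕ) : ∀ k, Φ fun t => (momentOP (μ t) n).coeff k := by
  induction n using Nat.strong_induction_on with
  | _ n ih =>
    intro k
    have hdeg : ∀ j t, (momentOP (μ t) j).natDegree ≤ j := fun j t =>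
      (monic_natDegree_momentOP (μ t) j).2.le
    have e : (fun t => (momentOP (μ t) n).coeff k) = fun t => (X ^ n : ℝ[X]).coeff k +
        ∑ j : Fin n, (-1) * ((PerturbedLaguerre.momentFunctional (μ t) (X ^ n * momentOP (μ t) j) /
          PerturbedLaguerre.momentFunctional (μ t) (momentOP (μ t) j ^ 2)) *
            (momentOP (μ t) j).coeff k) := by
      funext t
      conv_lhs => rw [momentOP]
      rw [coeff_sub, finsetSum_coeff, ← Finset.mul_sum]
      simp only [coeff_C_mul]
      ring
    rw [e]
    refine hΦ.add _ _ (hΦ.const _) (hΦ.sum _ _ fun j _ => hΦ.mul _ _ (hΦ.const _)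
      (hΦ.mul _ _ (hΦ.div _ _ ?_ ?_ (hpos.pos j).ne') (ih j j.isLt k)))
    · exact hΦ.momentFunctional_mul hμ (fun i => hΦ.const _) (ih j j.isLt)
        (fun t => (natDegree_X_pow n).le) (hdeg j)
    · simp only [sq]
      exact hΦ.momentFunctional_mul hμ (ih j j.isLt) (ih j j.isLt) (hdeg j) (hdeg j)

end IsFieldClosed

theorem hasDerivAt_momentFunctional {μ : ℝ → ℕ → ℝ} {μ' : ℕ → ℝ} {t : ℝ}
    (hμ : ∀ k, HasDerivAt (fun s => μ s k) (μ' k) t) (q : ℝ[X]) :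
    HasDerivAt (fun s => momentFunctional (μ s) q) (momentFunctional μ' q) t := by
  simp only [fun ν => momentFunctional_eq_sum ν (Nat.lt_succ_self q.natDegree)]
  exact HasDerivAt.fun_sum fun k _ => (hμ k).const_mul _

/-- Product rule with `q` frozen; orthogonality later makes freezing the second factor harmless. -/
theorem hasDerivAt_momentFunctional_mul {μ : ℝ → ℕ → ℝ} {μ' : ℕ → ℝ} {t : ℝ}
    (hμ : ∀ k, HasDerivAt (fun s => μ s k) (μ' k) t) {p : ℝ → ℝ[X]} {N : ℕ}
    (hN : ∀ s, (p s).natDegree ≤ N) {c : ℕ → ℝ}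
    (hp : ∀ k, HasDerivAt (fun s => (p s).coeff k) (c k) t) (q : ℝ[X]) :
    HasDerivAt (fun s => momentFunctional (μ s) (p s * q))
      (momentFunctional (μ t) ((∑ k ∈ Finset.range (N + 1), C (c k) * X ^ k) * q) +
        momentFunctional μ' (p t * q)) t := by
  have e : ∀ (ν : ℕ → ℝ) s, momentFunctional ν (p s * q) =
      ∑ k ∈ Finset.range (N + 1), (p s).coeff k * momentFunctional ν (X ^ k * q) := by
    intro ν s
    conv_lhs => rw [as_sum_range_C_mul_X_pow' (p s) (Nat.lt_succ_of_le (hN s))]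
    rw [Finset.sum_mul, map_sum]
    exact Finset.sum_congr rfl fun k _ => by rw [mul_assoc, linearMap_C_mul]
  have e2 : momentFunctional (μ t) ((∑ k ∈ Finset.range (N + 1), C (c k) * X ^ k) * q) =
      ∑ k ∈ Finset.range (N + 1), c k * momentFunctional (μ t) (X ^ k * q) := by
    rw [Finset.sum_mul, map_sum]
    exact Finset.sum_congr rfl fun k _ => by rw [mul_assoc, linearMap_C_mul]
  simp only [e, e2]
  rw [← Finset.sum_add_distrib]
  exact HasDerivAt.fun_sum fun k _ => (hp k).mul (hasDerivAt_momentFunctional hμ _)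

/-- The quantity `ladderR` of `kernel a gam t`, as a function of `t`. -/
def kernelR (a gam : ℝ) (n : ℕ) (t : ℝ) : ℝ :=
  ladderR gam (polyInt a gam t) (polyInt a (gam - 1) t) (kernelOP a gam t) n

/-- The quantity `ladderS` of `kernel a gam t`, as a function of `t`. -/
def kernelS (a gam : ℝ) (n : ℕ) (t : ℝ) : ℝ :=
  ladderS gam (polyInt a gam t) (polyInt a (gam - 1) t) (kernelOP a gam t) n

/-- The squared norm of the `n`-th monic orthogonal polynomial of `kernel a gam t`. -/
def kernelNorm (a gam : ℝ) (n : ℕ) (t : ℝ) : ℝ := polyInt a gam t (kernelOP a gam t n ^ 2)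

/-- The recurrence coefficient `β_n` of `kernel a gam t`. -/
def kernelBeta (a gam : ℝ) (n : ℕ) (t : ℝ) : ℝ := recBeta (polyInt a gam t) (kernelOP a gam t) n

/-- The subleading coefficient of the orthogonal polynomials of `kernel a gam t`. -/
def kernelNext (a gam : ℝ) (n : ℕ) (t : ℝ) : ℝ := (kernelOP a gam t n).nextCoeff

theorem natDegree_kernelOP (a gam : ℝ) (n : ℕ) (t : ℝ) : (kernelOP a gam t n).natDegree = n :=
  (monic_natDegree_momentOP _ n).2

namespace IsFieldClosed

variable {t₀ : ℝ} {Φ : (ℝ → ℝ) → Prop} {a gam : ℝ}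

theorem coeff_kernelOP (hΦ : IsFieldClosed t₀ Φ) (hadm : Admissible a gam t₀)
    (hL : ∀ k : ℕ, Φ (kernelInt a (gam + k))) (n k : ℕ) :
    Φ fun t => (kernelOP a gam t n).coeff k :=
  hΦ.coeff_momentOP (μ := fun t k => kernelInt a (gam + k) t) hL
    (isMonicOrthogonal_kernelOP hadm) n k

theorem kernelNext (hΦ : IsFieldClosed t₀ Φ) (hadm : Admissible a gam t₀)
    (hL : ∀ k : ℕ, Φ (kernelInt a (gam + k))) (n : ℕ) : Φ (kernelNext a gam n) := by
  unfold PerturbedLaguerre.kernelNext nextCoeff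
  simp only [natDegree_kernelOP]
  cases n with
  | zero => simpa using hΦ.const 0
  | succ n => simpa using hΦ.coeff_kernelOP hadm hL (n + 1) n

theorem polyInt_kernelOP_mul (hΦ : IsFieldClosed t₀ Φ) (hadm : Admissible a gam t₀)
    (hL : ∀ k : ℕ, Φ (kernelInt a (gam + k))) {b c : ℝ} (hN : ∀ k : ℕ, Φ (kernelInt b (c + k)))
    (m n : ℕ) : Φ fun t => polyInt b c t (kernelOP a gam t m * kernelOP a gam t n) :=
  hΦ.momentFunctional_mul (μ := fun t k => kernelInt b (c + k) t) hN
    (hΦ.coeff_kernelOP hadm hL m) (hΦ.coeff_kernelOP hadm hL n)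
    (fun t => (natDegree_kernelOP a gam m t).le) (fun t => (natDegree_kernelOP a gam n t).le)

theorem kernelNorm (hΦ : IsFieldClosed t₀ Φ) (hadm : Admissible a gam t₀)
    (hL : ∀ k : ℕ, Φ (kernelInt a (gam + k))) (n : ℕ) : Φ (kernelNorm a gam n) := by
  unfold PerturbedLaguerre.kernelNorm
  simp only [sq]
  exact hΦ.polyInt_kernelOP_mul hadm hL hL n n

theorem kernelR (hΦ : IsFieldClosed t₀ Φ) (hadm : Admissible a gam t₀)
    (hL : ∀ k : ℕ, Φ (kernelInt a (gam + k))) (hN : ∀ k : ℕ, Φ (kernelInt a (gam - 1 + k)))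
    (n : ℕ) : Φ (kernelR a gam n) := by
  refine hΦ.div _ (PerturbedLaguerre.kernelNorm a gam n) (hΦ.mul _ _ (hΦ.const gam) ?_)
    (hΦ.kernelNorm hadm hL n) ((isMonicOrthogonal_kernelOP hadm).pos n).ne'
  simp only [sq]
  exact hΦ.polyInt_kernelOP_mul hadm hL hN n n

theorem kernelS (hΦ : IsFieldClosed t₀ Φ) (hadm : Admissible a gam t₀)
    (hL : ∀ k : ℕ, Φ (kernelInt a (gam + k))) (hN : ∀ k : ℕ, Φ (kernelInt a (gam - 1 + k)))
    (n : ℕ) : Φ (kernelS a gam n) := by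
  cases n with
  | zero => exact hΦ.const 0
  | succ n =>
    exact hΦ.div _ (PerturbedLaguerre.kernelNorm a gam n) (hΦ.mul _ _ (hΦ.const gam)
      (hΦ.polyInt_kernelOP_mul hadm hL hN (n + 1) n))
      (hΦ.kernelNorm hadm hL n) ((isMonicOrthogonal_kernelOP hadm).pos n).ne'

end IsFieldClosed

theorem isFieldClosed_differentiableWithinAt (s : Set ℝ) (t₀ : ℝ) :
    IsFieldClosed t₀ fun f => DifferentiableWithinAt ℝ f s t₀ :=
  ⟨fun _ => differentiableWithinAt_const _, fun _ _ hf hg => hf.add hg,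
    fun _ _ hf hg => hf.mul hg, fun _ _ hf hg h => hf.div hg h⟩

theorem isFieldClosed_continuousWithinAt (s : Set ℝ) (t₀ : ℝ) :
    IsFieldClosed t₀ fun f => ContinuousWithinAt f s t₀ :=
  ⟨fun _ => continuousWithinAt_const, fun _ _ hf hg => hf.add hg,
    fun _ _ hf hg => hf.mul hg, fun _ _ hf hg h => hf.div hg h⟩

theorem isFieldClosed_contDiffAt (m : WithTop ℕ∞) (t₀ : ℝ) :
    IsFieldClosed t₀ fun f => ContDiffAt ℝ m f t₀ :=
  ⟨fun _ => contDiffAt_const, fun _ _ hf hg => hf.add hg,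
    fun _ _ hf hg => hf.mul hg, fun _ _ hf hg h => hf.div hg h⟩

/-! ### Derivatives in `t` of norms and subleading coefficients -/

section Positive

variable {a gam t : ℝ}

theorem contDiffAt_kernelInt (b : ℝ) {c : ℝ} (hc : -1 < c) (ht : 0 < t) (m : ℕ) :
    ContDiffAt ℝ m (kernelInt b c) t :=
  (contDiffOn_kernelInt hc m b).contDiffAt (Ioi_mem_nhds ht)

theorem contDiffAt_kernelNext (ht : 0 < t) (hgam : 0 < gam) (m n : ℕ) :
    ContDiffAt ℝ m (kernelNext a gam n) t :=
  (isFieldClosed_contDiffAt m t).kernelNext (Or.inl ⟨ht, by linarith⟩)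
    (fun k => contDiffAt_kernelInt a (by have : (0 : ℝ) ≤ k := k.cast_nonneg
                                         linarith) ht m) n

theorem contDiffAt_kernelR (ht : 0 < t) (hgam : 0 < gam) (m n : ℕ) :
    ContDiffAt ℝ m (kernelR a gam n) t :=
  (isFieldClosed_contDiffAt m t).kernelR (Or.inl ⟨ht, by linarith⟩)
    (fun k => contDiffAt_kernelInt a (by have : (0 : ℝ) ≤ k := k.cast_nonneg
                                         linarith) ht m)
    (fun k => contDiffAt_kernelInt a (by have : (0 : ℝ) ≤ k := k.cast_nonneg
                                         linarith) ht m) n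

/-- The `t`-derivative of the functional `polyInt a gam t`. -/
theorem momentFunctional_deriv (ht : 0 < t) (hgam : 0 < gam) (q : ℝ[X]) :
    momentFunctional (fun k => -kernelInt a (gam + k) t - a * kernelInt (a + 1) (gam + k) t) q =
      -polyInt a gam t (derivative q) - gam * polyInt a (gam - 1) t q := by
  -- Integration by parts trades the `w/(x+t)` term for `w/x` and the derivative of `q`.
  have h := (isLaguerreTriple (a := a) ht hgam).map_derivative q
  have h2 := linearMap_ext_X_pow
    (L := momentFunctional
      (fun k => -kernelInt a (gam + k) t - a * kernelInt (a + 1) (gam + k) t))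
    (M := -polyInt a gam t - a • polyInt (a + 1) gam t) (fun k => by
      simp [momentFunctional_X_pow, polyInt_X_pow]) q
  rw [h2, h]
  simp only [LinearMap.sub_apply, LinearMap.neg_apply, LinearMap.smul_apply, smul_eq_mul]
  ring

theorem differentiableAt_coeff_kernelOP (ht : 0 < t) (hgam : 0 < gam) (n k : ℕ) :
    DifferentiableAt ℝ (fun s => (kernelOP a gam s n).coeff k) t :=
  ((isFieldClosed_contDiffAt (1 : ℕ) t).coeff_kernelOP (Or.inl ⟨ht, by linarith⟩)
    (fun k => contDiffAt_kernelInt a (by have : (0 : ℝ) ≤ k := k.cast_nonneg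
                                         linarith) ht 1) n k).differentiableAt (by simp)

theorem hasDerivAt_polyInt_kernelOP_mul (ht : 0 < t) (hgam : 0 < gam) (n : ℕ) (q : ℝ[X]) :
    HasDerivAt (fun s => polyInt a gam s (kernelOP a gam s n * q))
      (polyInt a gam t ((∑ k ∈ Finset.range (n + 1),
          C (deriv (fun s => (kernelOP a gam s n).coeff k) t) * X ^ k) * q) +
        (-polyInt a gam t (derivative (kernelOP a gam t n * q)) -
          gam * polyInt a (gam - 1) t (kernelOP a gam t n * q))) t := by
  rw [← momentFunctional_deriv ht hgam]
  refine hasDerivAt_momentFunctional_mul (μ := fun s k => kernelInt a (gam + k) s)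
    (fun k => hasDerivAt_kernelInt ht ?_) (fun s => (natDegree_kernelOP a gam n s).le)
    (fun k => (differentiableAt_coeff_kernelOP ht hgam n k).hasDerivAt) q
  have : (0 : ℝ) ≤ k := k.cast_nonneg
  linarith

theorem natDegree_sum_deriv_coeff_le (c : ℕ → ℝ) {n : ℕ} (hc : c n = 0) :
    (∑ k ∈ Finset.range (n + 1), C (c k) * X ^ k).natDegree ≤ n - 1 := by
  rw [Finset.sum_range_succ, hc, C_0, zero_mul, add_zero]
  refine natDegree_sum_le_of_forall_le _ _ fun k hk => (natDegree_C_mul_X_pow_le _ _).trans ?_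
  have := Finset.mem_range.1 hk
  omega

theorem deriv_coeff_kernelOP_self (a gam t : ℝ) (n : ℕ) :
    deriv (fun s => (kernelOP a gam s n).coeff n) t = 0 := by
  have : (fun s => (kernelOP a gam s n).coeff n) = fun _ => 1 := by
    funext s
    have := (monic_natDegree_momentOP (fun k => kernelInt a (gam + k) s) n).1
    rwa [Monic, leadingCoeff, (monic_natDegree_momentOP _ n).2] at this
  rw [this, deriv_const]

theorem admissible_of_pos (ht : 0 < t) (hgam : 0 < gam) : Admissible a gam t :=
  Or.inl ⟨ht, by linarith⟩

/-- Near `t`, `h_n(s) = L_s(P_n(s) P_n(t))`, because `P_n(t)` is monic. The derivative of `P_n` in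
`t` has lower degree and drops out, leaving only the derivative of the functional. -/
theorem hasDerivAt_kernelNorm (ht : 0 < t) (hgam : 0 < gam) (n : ℕ) :
    HasDerivAt (kernelNorm a gam n) (-(kernelR a gam n t * kernelNorm a gam n t)) t := by
  have hP := isMonicOrthogonal_kernelOP (admissible_of_pos (a := a) ht hgam)
  have h1 := hasDerivAt_polyInt_kernelOP_mul (a := a) ht hgam n (kernelOP a gam t n)
  have h2 : polyInt a gam t ((∑ k ∈ Finset.range (n + 1),
      C (deriv (fun s => (kernelOP a gam s n).coeff k) t) * X ^ k) * kernelOP a gam t n) = 0 := by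
    rw [mul_comm]
    cases n with
    | zero => simp [deriv_coeff_kernelOP_self a gam t 0]
    | succ n =>
      exact hP.map_mul_of_natDegree_lt (Nat.lt_succ_of_le
        (natDegree_sum_deriv_coeff_le _ (deriv_coeff_kernelOP_self a gam t (n + 1))))
  have h3 : polyInt a gam t (derivative (kernelOP a gam t n * kernelOP a gam t n)) = 0 := by
    have e1 := (isLaguerreTriple (a := a) ht hgam).map_derivative (kernelOP a gam t n ^ 2)
    have e2 := (isLaguerreTriple (a := a) ht hgam).map_S_sq hP n
    have := (hP.pos n).ne'
    rw [ladderR] at e2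
    rw [← sq, e1, e2]
    field_simp
    ring
  have h4 : gam * polyInt a (gam - 1) t (kernelOP a gam t n * kernelOP a gam t n) =
      kernelR a gam n t * kernelNorm a gam n t := by
    rw [kernelR, ladderR, kernelNorm, div_mul_cancel₀ _ (hP.pos n).ne', sq]
  rw [h2, h3, h4] at h1
  refine (h1.congr_deriv (by ring)).congr_of_eventuallyEq ?_
  filter_upwards [Ioi_mem_nhds ht] with s hs
  have hPs := isMonicOrthogonal_kernelOP (admissible_of_pos (a := a) hs hgam)
  rw [hPs.map_mul_of_natDegree_le (natDegree_kernelOP a gam n t).le, hP.coeff_self, one_mul]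
  rfl

/-- Differentiate `L_s(P_{n+1}(s) P_n(t)) = 0` at `s = t`; the derivative of `P_{n+1}` contributes
its top coefficient `p_{n+1}'` times `h_n`. -/
theorem hasDerivAt_kernelNext (ht : 0 < t) (hgam : 0 < gam) (n : ℕ) :
    HasDerivAt (kernelNext a gam n) (kernelS a gam n t + n) t := by
  cases n with
  | zero =>
    have e : kernelNext a gam 0 = fun _ => 0 := by
      funext s
      simp [kernelNext, nextCoeff, natDegree_kernelOP]
    rw [e]
    simpa [kernelS, ladderS] using hasDerivAt_const t (0 : ℝ)
  | succ n =>
    have hP := isMonicOrthogonal_kernelOP (admissible_of_pos (a := a) ht hgam)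
    have h1 := hasDerivAt_polyInt_kernelOP_mul (a := a) ht hgam (n + 1) (kernelOP a gam t n)
    have h0 : HasDerivAt (fun s => polyInt a gam s (kernelOP a gam s (n + 1) * kernelOP a gam t n))
        0 t := by
      refine (hasDerivAt_const t (0 : ℝ)).congr_of_eventuallyEq ?_
      filter_upwards [Ioi_mem_nhds ht] with s hs
      have hPs := isMonicOrthogonal_kernelOP (admissible_of_pos (a := a) hs hgam)
      exact hPs.map_mul_of_natDegree_lt (by rw [natDegree_kernelOP]; omega)
    have h2 := h1.unique h0
    have hnext : kernelNext a gam (n + 1) = fun s => (kernelOP a gam s (n + 1)).coeff n := by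
      funext s
      rw [kernelNext, nextCoeff_of_natDegree_pos (by rw [natDegree_kernelOP]; omega),
        natDegree_kernelOP, Nat.add_sub_cancel]
    have h3 := natDegree_sum_deriv_coeff_le
      (fun k => deriv (fun s => (kernelOP a gam s (n + 1)).coeff k) t)
      (deriv_coeff_kernelOP_self a gam t (n + 1))
    rw [Nat.add_sub_cancel] at h3
    rw [mul_comm, hP.map_mul_of_natDegree_le h3, IsLaguerreTriple.map_derivative_mul_succ hP,
      finsetSum_coeff] at h2
    simp only [coeff_C_mul, coeff_X_pow, mul_ite, mul_one, mul_zero] at h2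
    rw [Finset.sum_ite_eq, if_pos (Finset.mem_range.2 (by omega)), ← hnext] at h2
    have hd := (contDiffAt_kernelNext (a := a) ht hgam 1 (n + 1)).differentiableAt (by simp)
    refine hd.hasDerivAt.congr_deriv ?_
    have := (hP.pos n).ne'
    rw [kernelS, ladderS]
    push_cast
    field_simp
    linarith

end Positive

/-! ### The first-order system for `R_n` and `r_n` -/

section Evolution

variable {a gam t : ℝ}

theorem kernelNorm_pos (h : Admissible a gam t) (n : ℕ) : 0 < kernelNorm a gam n t :=
  (isMonicOrthogonal_kernelOP h).pos n

theorem kernelR_pos (ht : 0 < t) (hgam : 0 < gam) (n : ℕ) : 0 < kernelR a gam n t := by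
  have h1 : 0 < polyInt a (gam - 1) t (kernelOP a gam t n ^ 2) :=
    polyInt_sq_pos (Or.inl ⟨ht, by linarith⟩) (monic_natDegree_momentOP _ n).1.ne_zero
  have h2 := (isMonicOrthogonal_kernelOP (admissible_of_pos (a := a) ht hgam)).pos n
  rw [kernelR, ladderR]
  positivity

/-- `(R_n - 1) h_n = a S(P_n²)` and `S(P_n²) > 0`; this is where `β + λ ≠ 0` enters. -/
theorem kernelR_ne_one (ht : 0 < t) (hgam : 0 < gam) (ha : a ≠ 0) (n : ℕ) :
    kernelR a gam n t ≠ 1 := by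
  intro h
  have h1 : 0 < polyInt (a + 1) gam t (kernelOP a gam t n ^ 2) :=
    polyInt_sq_pos (Or.inl ⟨ht, by linarith⟩) (monic_natDegree_momentOP _ n).1.ne_zero
  have h2 := (isLaguerreTriple (a := a) ht hgam).map_S_sq
    (isMonicOrthogonal_kernelOP (admissible_of_pos ht hgam)) n
  rw [kernelR] at h
  rw [h, sub_self, zero_mul] at h2
  exact mul_ne_zero ha h1.ne' h2

theorem kernelNext_sub (ht : 0 < t) (hgam : 0 < gam) (n : ℕ) :
    kernelNext a gam n t - kernelNext a gam (n + 1) t =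
      2 * n + 1 + gam - a + t * (kernelR a gam n t - 1) :=
  (isLaguerreTriple ht hgam).recAlpha_eq
    (isMonicOrthogonal_kernelOP (admissible_of_pos ht hgam)) n

theorem kernelBeta_eq (ht : 0 < t) (hgam : 0 < gam) (n : ℕ) :
    kernelBeta a gam n t = t * (kernelS a gam n t + n) - kernelNext a gam n t :=
  (isLaguerreTriple ht hgam).recBeta_eq
    (isMonicOrthogonal_kernelOP (admissible_of_pos ht hgam)) n

theorem kernelBeta_mul (ht : 0 < t) (hgam : 0 < gam) (n : ℕ) :
    kernelBeta a gam n t * kernelR a gam n t * (kernelR a gam n t - 1) =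
      -(kernelS a gam n t ^ 2 - gam * kernelS a gam n t) + kernelR a gam n t *
        ((a - gam - 2 * n) * kernelS a gam n t + n * (a - n)) :=
  (isLaguerreTriple ht hgam).recBeta_mul
    (isMonicOrthogonal_kernelOP (admissible_of_pos ht hgam)) n

theorem sum_kernelR (ht : 0 < t) (hgam : 0 < gam) (n : ℕ) :
    -(t * ∑ j ∈ Finset.range n, kernelR a gam j t) =
      n ^ 2 + n * (gam - a - t) + kernelNext a gam n t :=
  (isLaguerreTriple ht hgam).sum_ladderR
    (isMonicOrthogonal_kernelOP (admissible_of_pos ht hgam)) n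

/-- Solve the formula for `α_n` for `R_n` and differentiate; `r_{n+1}` is removed by `ladderS_add`.
-/
theorem hasDerivAt_kernelR (ht : 0 < t) (hgam : 0 < gam) (n : ℕ) :
    HasDerivAt (kernelR a gam n)
      ((2 * kernelS a gam n t - gam +
        (2 * n + gam - a - t + t * kernelR a gam n t) * kernelR a gam n t) / t) t := by
  have h1 := (((hasDerivAt_kernelNext (a := a) ht hgam n).sub
    (hasDerivAt_kernelNext (a := a) ht hgam (n + 1))).sub_const
      (2 * (n : ℝ) + 1 + gam - a)).div (hasDerivAt_id t) ht.ne'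
  have h2 := (h1.add_const 1).congr_of_eventuallyEq (f₁ := kernelR a gam n) (by
    filter_upwards [Ioi_mem_nhds ht] with s hs
    have hs : 0 < s := hs
    have := kernelNext_sub (a := a) hs hgam n
    simp only [Pi.sub_apply, Pi.div_apply, id]
    field_simp
    linarith)
  refine h2.congr_deriv ?_
  have e1 := kernelNext_sub (a := a) ht hgam n
  have e2 : kernelS a gam (n + 1) t + kernelS a gam n t = gam - (kernelNext a gam n t -
      kernelNext a gam (n + 1) t) * kernelR a gam n t :=
    (isLaguerreTriple ht hgam).ladderS_add
      (isMonicOrthogonal_kernelOP (admissible_of_pos ht hgam)) n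
  rw [e1] at e2
  simp only [Pi.sub_apply, id]
  rw [e1, eq_sub_of_add_eq e2]
  push_cast
  field_simp
  ring

/-- As a ratio of norms, `β_n' = β_n (R_{n-1} - R_n)`, and the pole relation at `0` replaces `β_n
R_{n-1}`. -/
theorem hasDerivAt_kernelBeta (ht : 0 < t) (hgam : 0 < gam) (n : ℕ) :
    HasDerivAt (kernelBeta a gam n)
      ((kernelS a gam n t ^ 2 - gam * kernelS a gam n t -
        kernelBeta a gam n t * kernelR a gam n t ^ 2) / kernelR a gam n t) t := by
  cases n with
  | zero =>
    have e : kernelBeta a gam 0 = fun _ => 0 := rfl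
    rw [e]
    refine (hasDerivAt_const t (0 : ℝ)).congr_deriv ?_
    simp [kernelS, ladderS]
  | succ n =>
    have hn := (kernelNorm_pos (admissible_of_pos (a := a) ht hgam) n).ne'
    have h1 := (hasDerivAt_kernelNorm (a := a) ht hgam (n + 1)).div
      (hasDerivAt_kernelNorm (a := a) ht hgam n) hn
    refine h1.congr_deriv ?_
    have e1 : kernelS a gam (n + 1) t ^ 2 - gam * kernelS a gam (n + 1) t =
        kernelBeta a gam (n + 1) t * kernelR a gam (n + 1) t * kernelR a gam n t :=
      (isLaguerreTriple ht hgam).ladder_pole_zero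
        (isMonicOrthogonal_kernelOP (admissible_of_pos ht hgam)) n
    have e2 : kernelBeta a gam (n + 1) t = kernelNorm a gam (n + 1) t / kernelNorm a gam n t := rfl
    have hR := (kernelR_pos (a := a) ht hgam (n + 1)).ne'
    rw [e1, e2]
    field_simp
    ring

/-- Differentiating `β_n = t(r_n + n) - p_n` with `p_n' = r_n + n` gives `t r_n' = β_n'`. -/
theorem hasDerivAt_kernelS (ht : 0 < t) (hgam : 0 < gam) (n : ℕ) :
    HasDerivAt (kernelS a gam n)
      ((kernelS a gam n t ^ 2 - gam * kernelS a gam n t -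
        kernelBeta a gam n t * kernelR a gam n t ^ 2) / kernelR a gam n t / t) t := by
  have h1 := ((hasDerivAt_kernelBeta (a := a) ht hgam n).add
    (hasDerivAt_kernelNext (a := a) ht hgam n)).div (hasDerivAt_id t) ht.ne'
  have h2 := (h1.sub_const (n : ℝ)).congr_of_eventuallyEq (f₁ := kernelS a gam n) (by
    filter_upwards [Ioi_mem_nhds ht] with s hs
    have hs : 0 < s := hs
    have := kernelBeta_eq (a := a) hs hgam n
    simp only [Pi.add_apply, Pi.div_apply, id]
    field_simp
    linarith)
  refine h2.congr_deriv ?_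
  have e1 := kernelBeta_eq (a := a) ht hgam n
  have hR := (kernelR_pos (a := a) ht hgam n).ne'
  simp only [Pi.add_apply, id]
  rw [show kernelBeta a gam n t + kernelNext a gam n t = t * (kernelS a gam n t + n) by
    rw [e1]; ring]
  field_simp
  ring

end Evolution

/-! ### Initial values at `t = 0` -/

section AtZero

variable {a gam : ℝ}

/-- The factor `X` leaves only `L` in the relation, so it also holds for `-1 < γ - a ≤ 0`, where
`w/x` is not integrable. -/
theorem polyInt_zero_derivative_X_mul (h : -1 < gam - a) (q : ℝ[X]) :
    polyInt a gam 0 (derivative (X * q)) =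
      (a - gam) * polyInt a gam 0 q + polyInt a gam 0 (X * q) := by
  refine linearMap_ext_X_pow
    (L := polyInt a gam 0 ∘ₗ derivative ∘ₗ LinearMap.mulLeft ℝ X)
    (M := (a - gam) • polyInt a gam 0 + polyInt a gam 0 ∘ₗ LinearMap.mulLeft ℝ X) (fun k => ?_) q
  have hk : (0 : ℝ) ≤ k := k.cast_nonneg
  have h1 := kernelInt_zero_add_one (b := a) (c := gam + k) (by linarith)
  simp only [LinearMap.comp_apply, LinearMap.add_apply, LinearMap.smul_apply, smul_eq_mul,
    LinearMap.mulLeft_apply]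
  rw [← pow_succ', derivative_X_pow, linearMap_C_mul, Nat.add_sub_cancel, polyInt_X_pow,
    polyInt_X_pow]
  push_cast
  rw [← add_assoc, h1]
  ring

theorem kernelNext_zero (h : -1 < gam - a) (n : ℕ) :
    kernelNext a gam n 0 = -(n ^ 2 + n * (gam - a)) := by
  have hP := isMonicOrthogonal_kernelOP (a := a) (gam := gam) (t := 0) (Or.inr ⟨rfl, h⟩)
  induction n with
  | zero => simp [kernelNext, hP.nextCoeff_zero]
  | succ n ih =>
    have h1 := polyInt_zero_derivative_X_mul h (kernelOP a gam 0 n ^ 2)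
    rw [hP.map_derivative_X_mul_sq, hP.map_X_mul_sq, ← add_mul] at h1
    have h2 := mul_right_cancel₀ (hP.pos n).ne' h1
    rw [kernelNext] at ih ⊢
    push_cast
    linarith

/-- At `t = 0` the two poles merge, so the same functional serves as `N` and `S`. -/
theorem isLaguerreTriple_zero (h : 0 < gam - a) :
    IsLaguerreTriple a gam 0 (polyInt a gam 0) (polyInt a (gam - 1) 0)
      (polyInt a (gam - 1) 0) := by
  have hX : ∀ q, polyInt a (gam - 1) 0 (X * q) = polyInt a gam 0 q := fun q => by
    refine linearMap_ext_X_pow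
      (L := polyInt a (gam - 1) 0 ∘ₗ LinearMap.mulLeft ℝ X) (fun k => ?_) q
    rw [LinearMap.comp_apply, LinearMap.mulLeft_apply, ← pow_succ', polyInt_X_pow, polyInt_X_pow]
    congr 1
    push_cast
    ring
  refine ⟨hX, fun q => by simpa using hX q, fun q => ?_⟩
  refine linearMap_ext_X_pow (L := polyInt a gam 0 ∘ₗ derivative)
    (M := a • polyInt a (gam - 1) 0 - gam • polyInt a (gam - 1) 0 + polyInt a gam 0)
    (fun k => ?_) q
  have hk : (0 : ℝ) ≤ k := k.cast_nonneg
  have h1 := kernelInt_zero_add_one (b := a) (c := gam + k - 1) (by linarith)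
  rw [sub_add_cancel] at h1
  have h2 : polyInt a gam 0 (derivative (X ^ k)) = k * kernelInt a (gam + k - 1) 0 := by
    rw [derivative_X_pow, linearMap_C_mul, polyInt_X_pow]
    cases k with
    | zero => simp
    | succ k => congr 2; push_cast; ring
  simp only [LinearMap.comp_apply, LinearMap.add_apply, LinearMap.sub_apply,
    LinearMap.smul_apply, smul_eq_mul, polyInt_X_pow]
  rw [h2, show gam - 1 + (k : ℝ) = gam + k - 1 by ring, h1]
  ring

theorem kernelR_zero (hgam : 0 < gam) (h : 0 < gam - a) (n : ℕ) :
    kernelR a gam n 0 = gam / (gam - a) := by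
  have hP := isMonicOrthogonal_kernelOP (a := a) (gam := gam) (t := 0)
    (Or.inr ⟨rfl, by linarith⟩)
  have h1 := (isLaguerreTriple_zero h).map_S_sq hP n
  have h2 := (hP.pos n).ne'
  rw [ladderR] at h1
  rw [kernelR, ladderR]
  field_simp at h1 ⊢
  linarith

theorem kernelS_zero (h : 0 < gam - a) (n : ℕ) :
    kernelS a gam n 0 = -(n * gam / (gam - a)) := by
  cases n with
  | zero => simp [kernelS, ladderS]
  | succ n =>
    have hP := isMonicOrthogonal_kernelOP (a := a) (gam := gam) (t := 0)
      (Or.inr ⟨rfl, by linarith⟩)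
    have h1 := (isLaguerreTriple_zero h).map_S_mul_succ hP n
    have h2 := (hP.pos n).ne'
    rw [ladderS] at h1
    rw [kernelS, ladderS]
    push_cast
    field_simp at h1 ⊢
    linear_combination (-gam) * h1

theorem continuousWithinAt_kernelNext_zero (hgam : 0 < gam) (h : -1 < gam - a) (n : ℕ) :
    ContinuousWithinAt (kernelNext a gam n) (Ici 0) 0 := by
  refine (isFieldClosed_continuousWithinAt (Ici 0) 0).kernelNext (Or.inr ⟨rfl, h⟩) (fun k => ?_) n
  have : (0 : ℝ) ≤ k := k.cast_nonneg
  exact continuousWithinAt_kernelInt_zero (by linarith) (by linarith)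

theorem continuousWithinAt_kernelR_zero (hgam : 0 < gam) (h : 0 < gam - a) (n : ℕ) :
    ContinuousWithinAt (kernelR a gam n) (Ici 0) 0 := by
  refine (isFieldClosed_continuousWithinAt (Ici 0) 0).kernelR (Or.inr ⟨rfl, by linarith⟩)
    (fun k => ?_) (fun k => ?_) n
  all_goals
    have : (0 : ℝ) ≤ k := k.cast_nonneg
    exact continuousWithinAt_kernelInt_zero (by linarith) (by linarith)

theorem differentiableWithinAt_kernelR_zero (hgam : 0 < gam) (h : 1 < gam - a) (n : ℕ) :
    DifferentiableWithinAt ℝ (kernelR a gam n) (Ici 0) 0 := by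
  refine (isFieldClosed_differentiableWithinAt (Ici 0) 0).kernelR (Or.inr ⟨rfl, by linarith⟩)
    (fun k => ?_) (fun k => ?_) n
  all_goals
    have : (0 : ℝ) ≤ k := k.cast_nonneg
    exact differentiableWithinAt_kernelInt_zero (by linarith) (by linarith)

theorem differentiableWithinAt_kernelS_zero (hgam : 0 < gam) (h : 1 < gam - a) (n : ℕ) :
    DifferentiableWithinAt ℝ (kernelS a gam n) (Ici 0) 0 := by
  refine (isFieldClosed_differentiableWithinAt (Ici 0) 0).kernelS (Or.inr ⟨rfl, by linarith⟩)
    (fun k => ?_) (fun k => ?_) n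
  all_goals
    have : (0 : ℝ) ≤ k := k.cast_nonneg
    exact differentiableWithinAt_kernelInt_zero (by linarith) (by linarith)

/-- If `t` times the derivative of `f` equals `F` on `(0,∞)`, where `f` and `F` are differentiable
from the right at `0` and `F 0 = 0`, then `f` and `F` have the same derivative at `0`. -/
theorem hasDerivWithinAt_zero_unique {f F : ℝ → ℝ} {ρ ρ' : ℝ}
    (hf : HasDerivWithinAt f ρ (Ici 0) 0) (hF : HasDerivWithinAt F ρ' (Ici 0) 0) (hF0 : F 0 = 0)
    (h : ∀ t, 0 < t → HasDerivAt f (F t / t) t) : ρ = ρ' := by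
  have h1 : Tendsto (fun t => deriv f t) (𝓝[>] 0) (𝓝 ρ') := by
    have h2 := hasDerivWithinAt_iff_tendsto_slope.1 hF
    rw [Ici_sdiff_left] at h2
    refine h2.congr' ?_
    filter_upwards [self_mem_nhdsWithin] with t ht
    rw [(h t ht).deriv, slope_def_field, hF0, sub_zero, sub_zero]
  have h3 := hasDerivWithinAt_Ici_of_tendsto_deriv (s := Ioi 0)
    (fun t ht => (h t ht).differentiableAt.differentiableWithinAt)
    (hf.continuousWithinAt.mono Ioi_subset_Ici_self) self_mem_nhdsWithin h1
  exact (uniqueDiffWithinAt_Ici (0 : ℝ)).eq_deriv _ hf h3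

theorem hasDerivWithinAt_kernelR_zero (hgam : 0 < gam) (h : 1 < gam - a) (ha : a ≠ 0) (n : ℕ) :
    HasDerivWithinAt (kernelR a gam n)
      ((2 * n + 1 + gam - a) * a * gam / ((gam - a) ^ 2 * (1 - (gam - a) ^ 2))) (Ici 0) 0 := by
  have hR := (differentiableWithinAt_kernelR_zero hgam h n).hasDerivWithinAt
  have hS := (differentiableWithinAt_kernelS_zero hgam h n).hasDerivWithinAt
  set ρ := derivWithin (kernelR a gam n) (Ici 0) 0
  set κ := derivWithin (kernelS a gam n) (Ici 0) 0
  have hR0 := kernelR_zero hgam (show 0 < gam - a by linarith) n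
  have hS0 := kernelS_zero (show 0 < gam - a by linarith) n
  -- Use `g = γ - a`, the Laguerre exponent at `t = 0`, as parameter.
  obtain ⟨g, rfl⟩ : ∃ g, a = gam - g := ⟨gam - a, by ring⟩
  rw [sub_sub_cancel] at *
  have hg : g ≠ 0 := by linarith
  have hid := hasDerivWithinAt_id (0 : ℝ) (Ici 0)
  have e1 := hasDerivWithinAt_zero_unique hR (((hS.const_mul 2).sub_const gam).add
      (((hid.const_sub (2 * n + gam - (gam - g))).add (hid.mul hR)).mul hR)) (by
    simp only [Pi.add_apply, Pi.mul_apply, id, hR0, hS0]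
    field_simp
    ring) (fun t ht => hasDerivAt_kernelR ht hgam n)
  have hX := (hS.pow 2).sub (hS.const_mul gam)
  -- For the second equation `β_n` is eliminated by `kernelBeta_mul`, so the right side depends on
  -- `R` and `r` only; this requires `R ≠ 0` and `R ≠ 1` at `0`.
  have hR0' : kernelR (gam - g) gam n 0 ≠ 0 := by
    rw [hR0]; positivity
  have hR1' : kernelR (gam - g) gam n 0 - 1 ≠ 0 := by
    rw [hR0, div_sub_one hg]
    exact div_ne_zero ha hg
  have e2 := hasDerivWithinAt_zero_unique hS ((hX.div hR hR0').sub
      ((hX.neg.add (hR.mul ((hS.const_mul (gam - g - gam - 2 * n)).add_const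
        ((n : ℝ) * (gam - g - n))))).div (hR.sub_const 1) hR1')) (by
    simp only [Pi.add_apply, Pi.mul_apply, Pi.sub_apply, Pi.neg_apply, Pi.pow_apply, Pi.div_apply,
      hR0, hS0]
    rw [hR0] at hR1'
    have : gam - g ≠ 0 := ha
    field_simp
    ring) (fun t ht => by
    refine (hasDerivAt_kernelS ht hgam n).congr_deriv ?_
    have k1 := kernelBeta_mul (a := gam - g) ht hgam n
    have k2 := (kernelR_pos (a := gam - g) ht hgam n).ne'
    have k3 := sub_ne_zero.2 (kernelR_ne_one (a := gam - g) ht hgam ha n)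
    simp only [Pi.add_apply, Pi.mul_apply, Pi.sub_apply, Pi.neg_apply, Pi.pow_apply, Pi.div_apply]
    congr 1
    field_simp
    linear_combination (-kernelR (gam - g) gam n t) * k1)
  simp only [Pi.add_apply, Pi.mul_apply, Pi.sub_apply, Pi.neg_apply, Pi.pow_apply, id,
    hR0, hS0] at e1 e2
  rw [div_sub_one hg] at e2
  have f1 : (1 - 2 * n - g) * ρ * g ^ 2 - 2 * κ * g ^ 2 = gam * (gam - g) := by
    field_simp at e1
    linear_combination e1
  have f2 : (1 + 2 * n + g) * κ = -(2 * n * (n + g)) * ρ := by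
    push_cast at e2
    field_simp at e2
    refine mul_right_cancel₀ (pow_ne_zero 2 ha) ?_
    linear_combination e2
  have hg2 : 1 - g ^ 2 ≠ 0 := by nlinarith
  refine hR.congr_deriv ?_
  rw [eq_div_iff (by positivity)]
  -- Cramer's rule for the slopes: eliminating `κ` leaves the determinant `1 - g²`, nonzero since `g
  -- > 1`.
  linear_combination (1 + 2 * n + g) * f1 + 2 * g ^ 2 * f2

end AtZero

/-! ### Elimination: the σ-form, Painlevé V and the Hamiltonian formula -/

/-- Write `Q = r² - γr`. Then `(t r' R)² = (Q + βR²)² - 4QβR²`, while `hβ` says `Q + βR² = R(β +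
(a-γ-2n)r + n(a-n))`. Dividing by `R²` removes `R`, and `hH` expresses `β` through `H` and `r = H'`.
-/
theorem sigma_form_algebra {t n a gam R r β H r' : ℝ} (hR : R ≠ 0)
    (hβ : β * R * (R - 1) = -(r ^ 2 - gam * r) + R * ((a - gam - 2 * n) * r + n * (a - n)))
    (hr : t * r' * R = r ^ 2 - gam * r - β * R ^ 2)
    (hH : H = n ^ 2 + n * (gam - a) + t * r - β) :
    (t * r') ^ 2 = 4 * (n + r) * (H - t * r) * (r - gam) +
      ((t - gam + a) * r - H - n * gam) ^ 2 := by
  refine mul_right_cancel₀ (pow_ne_zero 2 hR) ?_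
  subst hH
  linear_combination (t * r' * R + (r ^ 2 - gam * r - β * R ^ 2)) * hr +
    ((r ^ 2 - gam * r + β * R ^ 2) + R * (β + (a - gam - 2 * n) * r + n * (a - n))) * hβ

theorem jimbo_miwa_okamoto_algebra {t n a gam H r r' : ℝ}
    (h : (t * r') ^ 2 = 4 * (n + r) * (H - t * r) * (r - gam) +
      ((t - gam + a) * r - H - n * gam) ^ 2) :
    (t * r') ^ 2 =
      ((H + n * t + n * a) - t * (r + n) + 2 * (r + n) ^ 2 +
        (0 + -n + -a + (-n - gam)) * (r + n)) ^ 2 -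
        4 * (0 + (r + n)) * (-n + (r + n)) * (-a + (r + n)) * (-n - gam + (r + n)) := by
  linear_combination h

/-- The second derivative of `y = 1 + 1 / w`, where `w = R - 1` is a solution of the first-order
system for `(R, r)`. -/
theorem painleve_five_algebra {t w n a gam r β F R' r' F' y y' : ℝ} (ht : t ≠ 0) (hw : w ≠ 0)
    (hw1 : w + 1 ≠ 0)
    (hβ : β * (w + 1) * w =
      -(r ^ 2 - gam * r) + (w + 1) * ((a - gam - 2 * n) * r + n * (a - n)))
    (hF : F = 2 * r - gam + (2 * n + gam - a - t + t * (w + 1)) * (w + 1))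
    (hR' : R' = F / t) (hr' : r' = (r ^ 2 - gam * r - β * (w + 1) ^ 2) / (w + 1) / t)
    (hF' : F' = 2 * r' + ((-1 + ((w + 1) + t * R')) * (w + 1) +
      (2 * n + gam - a - t + t * (w + 1)) * R'))
    (hy : y = 1 + 1 / w) (hy' : y' = -(F / (t * w ^ 2))) :
    -((F' * (t * w ^ 2) - F * (w ^ 2 + t * (2 * w * R'))) / (t * w ^ 2) ^ 2) =
      (3 * y - 1) * y' ^ 2 / (2 * y * (y - 1)) - y' / t
        + (y - 1) ^ 2 / (2 * t ^ 2) * (a ^ 2 * y - gam ^ 2 / y)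
        - (2 * n + 1 + gam - a) * y / t
        - y * (y + 1) / (2 * (y - 1)) := by
  -- Once `β` is solved for, both sides are rational functions of `t`, `w`, `r` and the parameters.
  have hβ' : β = (-(r ^ 2 - gam * r) + (w + 1) * ((a - gam - 2 * n) * r + n * (a - n))) /
      ((w + 1) * w) := by
    rw [eq_div_iff (mul_ne_zero hw1 hw)]
    linarith
  have hy1 : y = (w + 1) / w := by rw [hy]; field_simp
  have hy2 : y - 1 = 1 / w := by rw [hy]; ring
  have hy3 : y + 1 = (2 * w + 1) / w := by rw [hy]; field_simp; ring
  have hy4 : 3 * y - 1 = (2 * w + 3) / w := by rw [hy]; field_simp; ring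
  rw [hy2, hy3, hy4, hy1, hy', hF', hr', hR', hβ', hF]
  field_simp
  ring

theorem hamiltonian_algebra {t w n a gam r β F H y y' : ℝ} (ht : t ≠ 0) (hw : w ≠ 0)
    (hw1 : w + 1 ≠ 0)
    (hβ : β * (w + 1) * w =
      -(r ^ 2 - gam * r) + (w + 1) * ((a - gam - 2 * n) * r + n * (a - n)))
    (hF : F = 2 * r - gam + (2 * n + gam - a - t + t * (w + 1)) * (w + 1))
    (hH : H = n ^ 2 + n * (gam - a) + t * r - β)
    (hy : y = 1 + 1 / w) (hy' : y' = -(F / (t * w ^ 2))) :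
    H = (t * y') ^ 2 / (4 * y * (y - 1) ^ 2) - (a * y - gam) ^ 2 / (4 * y)
      + t * (a - 2 * n) * y / (2 * (y - 1)) - gam * t / (2 * (y - 1))
      - t ^ 2 * y / (4 * (y - 1) ^ 2) := by
  have hβ' : β = (-(r ^ 2 - gam * r) + (w + 1) * ((a - gam - 2 * n) * r + n * (a - n))) /
      ((w + 1) * w) := by
    rw [eq_div_iff (mul_ne_zero hw1 hw)]
    linarith
  have hy1 : y = (w + 1) / w := by rw [hy]; field_simp
  have hy2 : y - 1 = 1 / w := by rw [hy]; ring
  rw [hy2, hy1, hH, hy', hβ', hF]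
  field_simp
  ring

/-! ### Transfer to `R̂_n`, `Ĥ_n` and `ŷ` -/

section Parameters

variable {lam bet gam : ℝ}

theorem admissible_of_nonneg {a t : ℝ} (hgam : 0 < gam) (h : -1 < gam - a) (ht : 0 ≤ t) :
    Admissible a gam t := by
  rcases ht.eq_or_lt with rfl | ht
  · exact Or.inr ⟨rfl, h⟩
  · exact admissible_of_pos ht hgam

theorem Rhat_eq_kernelR (hgam : 0 < gam) {t : ℝ} (ht : 0 < t) (n : ℕ) :
    Rhat lam bet gam n t = kernelR (lam + bet) gam n t :=
  Rhat_eq_ladderR (admissible_of_pos ht hgam) (Or.inl ⟨ht, by linarith⟩) n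

theorem Rhat_eq_kernelR_of_nonneg (hgam : 0 < gam) (h : 0 < gam - (lam + bet)) {t : ℝ}
    (ht : 0 ≤ t) (n : ℕ) : Rhat lam bet gam n t = kernelR (lam + bet) gam n t := by
  rcases ht.eq_or_lt with rfl | ht
  · exact Rhat_eq_ladderR (Or.inr ⟨rfl, by linarith⟩) (Or.inr ⟨rfl, by linarith⟩) n
  · exact Rhat_eq_kernelR hgam ht n

theorem hankelDet_pos (hgam : 0 < gam) (h : -1 < gam - (lam + bet)) {t : ℝ} (ht : 0 ≤ t) (n : ℕ) :
    0 < hankelDet lam bet gam n t := by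
  have hadm := admissible_of_nonneg hgam h ht
  rw [hankelDet_eq_prod hadm]
  exact Finset.prod_pos fun j _ => kernelNorm_pos hadm j

theorem hasDerivAt_log_hankelDet (hgam : 0 < gam) (h : -1 < gam - (lam + bet)) {t : ℝ}
    (ht : 0 < t) (n : ℕ) :
    HasDerivAt (fun s => Real.log (hankelDet lam bet gam n s / hankelDet lam bet gam n 0))
      (-∑ j ∈ Finset.range n, Rhat lam bet gam j t) t := by
  have h1 : HasDerivAt (fun s => ∑ j ∈ Finset.range n,
      Real.log (kernelNorm (lam + bet) gam j s) - Real.log (hankelDet lam bet gam n 0))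
      (∑ j ∈ Finset.range n, -(kernelR (lam + bet) gam j t * kernelNorm (lam + bet) gam j t) /
        kernelNorm (lam + bet) gam j t) t :=
    (HasDerivAt.fun_sum fun j _ => (hasDerivAt_kernelNorm ht hgam j).log
      (kernelNorm_pos (admissible_of_pos ht hgam) j).ne').sub_const _
  refine (h1.congr_deriv ?_).congr_of_eventuallyEq ?_
  · rw [← Finset.sum_neg_distrib]
    refine Finset.sum_congr rfl fun j _ => ?_
    have := (kernelNorm_pos (admissible_of_pos (a := lam + bet) ht hgam) j).ne'
    rw [Rhat_eq_kernelR hgam ht]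
    field_simp
  · filter_upwards [Ioi_mem_nhds ht] with s hs
    have hadm := admissible_of_pos (a := lam + bet) (gam := gam) hs hgam
    rw [Real.log_div (hankelDet_pos hgam h (le_of_lt hs) n).ne'
      (hankelDet_pos hgam h le_rfl n).ne', hankelDet_eq_prod hadm, Real.log_prod]
    · rfl
    · exact fun j _ => (kernelNorm_pos hadm j).ne'

theorem Hhat_eq_sum (hgam : 0 < gam) (h : -1 < gam - (lam + bet)) {t : ℝ} (ht : 0 < t) (n : ℕ) :
    Hhat lam bet gam n t = -(t * ∑ j ∈ Finset.range n, kernelR (lam + bet) gam j t) := by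
  rw [Hhat, (hasDerivAt_log_hankelDet hgam h ht n).deriv, mul_neg,
    Finset.sum_congr rfl fun j _ => Rhat_eq_kernelR hgam ht j]

theorem Hhat_zero (n : ℕ) : Hhat lam bet gam n 0 = 0 := by
  rw [Hhat, zero_mul]

/-- Including `t = 0` gives continuity of `Ĥ_n` there for all admissible parameters, without using
`R̂_j(0)`. -/
theorem Hhat_eq_kernelNext (hgam : 0 < gam) (h : -1 < gam - (lam + bet)) {t : ℝ} (ht : 0 ≤ t)
    (n : ℕ) : Hhat lam bet gam n t =
      n ^ 2 + n * (gam - (lam + bet) - t) + kernelNext (lam + bet) gam n t := by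
  rcases ht.eq_or_lt with rfl | ht
  · rw [Hhat_zero, kernelNext_zero h]
    ring
  · rw [Hhat_eq_sum hgam h ht, sum_kernelR ht hgam]

theorem Hhat_eq_kernelBeta (hgam : 0 < gam) (h : -1 < gam - (lam + bet)) {t : ℝ} (ht : 0 < t)
    (n : ℕ) : Hhat lam bet gam n t =
      n ^ 2 + n * (gam - (lam + bet)) + t * kernelS (lam + bet) gam n t -
        kernelBeta (lam + bet) gam n t := by
  rw [Hhat_eq_kernelNext hgam h ht.le, kernelBeta_eq ht hgam]
  ring

theorem hasDerivAt_Hhat (hgam : 0 < gam) (h : -1 < gam - (lam + bet)) {t : ℝ} (ht : 0 < t)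
    (n : ℕ) : HasDerivAt (Hhat lam bet gam n) (kernelS (lam + bet) gam n t) t := by
  have h1 := ((((hasDerivAt_id t).const_sub (gam - (lam + bet))).const_mul (n : ℝ)).const_add
    ((n : ℝ) ^ 2)).add (hasDerivAt_kernelNext (a := lam + bet) ht hgam n)
  refine (h1.congr_deriv (by ring)).congr_of_eventuallyEq ?_
  filter_upwards [Ioi_mem_nhds ht] with s hs
  exact Hhat_eq_kernelNext hgam h (le_of_lt hs) n

theorem deriv_deriv_Hhat (hgam : 0 < gam) (h : -1 < gam - (lam + bet)) {t : ℝ} (ht : 0 < t)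
    (n : ℕ) : deriv (deriv (Hhat lam bet gam n)) t =
      (kernelS (lam + bet) gam n t ^ 2 - gam * kernelS (lam + bet) gam n t -
        kernelBeta (lam + bet) gam n t * kernelR (lam + bet) gam n t ^ 2) /
          kernelR (lam + bet) gam n t / t := by
  rw [← (hasDerivAt_kernelS (a := lam + bet) ht hgam n).deriv]
  refine Filter.EventuallyEq.deriv_eq ?_
  filter_upwards [Ioi_mem_nhds ht] with s hs
  exact (hasDerivAt_Hhat hgam h hs n).deriv

theorem contDiffOn_Hhat (hgam : 0 < gam) (h : -1 < gam - (lam + bet)) (m n : ℕ) :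
    ContDiffOn ℝ m (Hhat lam bet gam n) (Ioi 0) := by
  refine ContDiffOn.congr (f := fun t => n ^ 2 + n * (gam - (lam + bet) - t) +
    kernelNext (lam + bet) gam n t) (fun t ht => ContDiffAt.contDiffWithinAt ?_)
    fun t ht => Hhat_eq_kernelNext hgam h (le_of_lt ht) n
  exact (contDiffAt_const.add (contDiffAt_const.mul (contDiffAt_const.sub contDiffAt_id))).add
    (contDiffAt_kernelNext ht hgam m n)

theorem Hhat_sigma (hgam : 0 < gam) (h : -1 < gam - (lam + bet)) {t : ℝ} (ht : 0 < t) (n : ℕ) :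
    (t * deriv (deriv (Hhat lam bet gam n)) t) ^ 2 =
      4 * (n + deriv (Hhat lam bet gam n) t) *
          (Hhat lam bet gam n t - t * deriv (Hhat lam bet gam n) t) *
          (deriv (Hhat lam bet gam n) t - gam) +
        ((t - gam + (lam + bet)) * deriv (Hhat lam bet gam n) t - Hhat lam bet gam n t
          - n * gam) ^ 2 := by
  have hR := (kernelR_pos (a := lam + bet) ht hgam n).ne'
  rw [(hasDerivAt_Hhat hgam h ht n).deriv, deriv_deriv_Hhat hgam h ht]
  refine sigma_form_algebra hR (kernelBeta_mul ht hgam n) ?_ (Hhat_eq_kernelBeta hgam h ht n)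
  field_simp

theorem satisfiesSigmaPV_Hhat (hgam : 0 < gam) (h : -1 < gam - (lam + bet)) (n : ℕ) :
    SatisfiesSigmaPV 0 (-n) (-bet - lam) (-n - gam)
      (fun t => Hhat lam bet gam n t + n * t + n * (bet + lam)) := by
  have hd : ∀ t, 0 < t → HasDerivAt (fun t => Hhat lam bet gam n t + n * t + n * (bet + lam))
      (deriv (Hhat lam bet gam n) t + n) t := fun t ht => by
    have h1 := (hasDerivAt_Hhat hgam h ht n).differentiableAt.hasDerivAt
    exact (((h1.add ((hasDerivAt_id t).const_mul (n : ℝ))).add_const _).congr_deriv (by ring))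
  refine ⟨?_, fun t ht => ?_⟩
  · exact ((contDiffOn_Hhat hgam h 2 n).add (contDiffOn_const.mul contDiffOn_id)).add
      contDiffOn_const
  · have h2 : deriv (deriv fun t => Hhat lam bet gam n t + n * t + n * (bet + lam)) t =
        deriv (deriv (Hhat lam bet gam n)) t := by
      rw [← deriv_add_const (f := deriv (Hhat lam bet gam n)) (x := t) (n : ℝ)]
      refine Filter.EventuallyEq.deriv_eq ?_
      filter_upwards [Ioi_mem_nhds ht] with s hs
      exact (hd s hs).deriv
    rw [h2, (hd t ht).deriv]
    have := jimbo_miwa_okamoto_algebra (Hhat_sigma hgam h ht n)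
    rw [this]
    ring

/-- The difference quotient `Ĥ_n(t)/t` is exactly `-∑ R̂_j(t)`, so continuity of the `R̂_j` at `0`
suffices. -/
theorem hasDerivWithinAt_Hhat_zero (hgam : 0 < gam) (h : 0 < gam - (lam + bet)) (n : ℕ) :
    HasDerivWithinAt (Hhat lam bet gam n) (n * gam / (lam + bet - gam)) (Ici 0) 0 := by
  rw [hasDerivWithinAt_iff_tendsto_slope, Ici_sdiff_left]
  have h1 : Tendsto (fun t => -∑ j ∈ Finset.range n, kernelR (lam + bet) gam j t) (𝓝[>] 0)
      (𝓝 (-∑ j ∈ Finset.range n, kernelR (lam + bet) gam j 0)) :=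
    (tendsto_finsetSum _ fun j _ =>
      (continuousWithinAt_kernelR_zero hgam h j).mono Ioi_subset_Ici_self).neg
  have h2 : -∑ j ∈ Finset.range n, kernelR (lam + bet) gam j 0 = n * gam / (lam + bet - gam) := by
    rw [Finset.sum_congr rfl fun j _ => kernelR_zero hgam h j, Finset.sum_const,
      Finset.card_range, nsmul_eq_mul, ← neg_sub gam (lam + bet), div_neg, mul_div_assoc]
  rw [h2] at h1
  refine h1.congr' ?_
  filter_upwards [self_mem_nhdsWithin] with t ht
  have ht0 : t ≠ 0 := ne_of_gt ht
  rw [slope_def_field, Hhat_zero, Hhat_eq_sum hgam (by linarith) ht]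
  field_simp
  ring

theorem continuousWithinAt_Hhat_zero (hgam : 0 < gam) (h : -1 < gam - (lam + bet)) (n : ℕ) :
    ContinuousWithinAt (Hhat lam bet gam n) (Ici 0) 0 := by
  refine ContinuousWithinAt.congr (f := fun t => n ^ 2 + n * (gam - (lam + bet) - t) +
    kernelNext (lam + bet) gam n t) ?_ (fun t ht => Hhat_eq_kernelNext hgam h ht n)
    (Hhat_eq_kernelNext hgam h le_rfl n)
  exact ContinuousWithinAt.add (by fun_prop) (continuousWithinAt_kernelNext_zero hgam h n)

theorem yhat_eq_kernelR (hgam : 0 < gam) {t : ℝ} (ht : 0 < t) (n : ℕ) :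
    yhat lam bet gam n t = 1 + 1 / (kernelR (lam + bet) gam n t - 1) := by
  rw [yhat, Rhat_eq_kernelR hgam ht]

theorem yhat_eq_kernelR_of_nonneg (hgam : 0 < gam) (h : 0 < gam - (lam + bet)) {t : ℝ}
    (ht : 0 ≤ t) (n : ℕ) :
    yhat lam bet gam n t = 1 + 1 / (kernelR (lam + bet) gam n t - 1) := by
  rw [yhat, Rhat_eq_kernelR_of_nonneg hgam h ht]

theorem contDiffOn_yhat (hgam : 0 < gam) (ha : lam + bet ≠ 0) (m n : ℕ) :
    ContDiffOn ℝ m (yhat lam bet gam n) (Ioi 0) := by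
  refine ContDiffOn.congr (f := fun t => 1 + 1 / (kernelR (lam + bet) gam n t - 1))
    (fun t ht => ContDiffAt.contDiffWithinAt ?_) fun t ht => yhat_eq_kernelR hgam ht n
  exact contDiffAt_const.add (contDiffAt_const.div
    ((contDiffAt_kernelR ht hgam m n).sub contDiffAt_const)
    (sub_ne_zero.2 (kernelR_ne_one ht hgam ha n)))

theorem yhat_ne (hgam : 0 < gam) (ha : lam + bet ≠ 0) {t : ℝ} (ht : 0 < t) (n : ℕ) :
    yhat lam bet gam n t ≠ 0 ∧ yhat lam bet gam n t ≠ 1 ∧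
      Rhat lam bet gam n t = 1 + 1 / (yhat lam bet gam n t - 1) := by
  have h1 := sub_ne_zero.2 (kernelR_ne_one (a := lam + bet) ht hgam ha n)
  have h2 := (kernelR_pos (a := lam + bet) ht hgam n).ne'
  rw [yhat_eq_kernelR hgam ht, Rhat_eq_kernelR hgam ht]
  refine ⟨?_, by simpa using h1, by simp⟩
  rw [show 1 + 1 / (kernelR (lam + bet) gam n t - 1) =
    kernelR (lam + bet) gam n t / (kernelR (lam + bet) gam n t - 1) by field_simp; ring]
  exact div_ne_zero h2 h1

/-- The derivative of `kernelR` multiplied by `t`. -/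
def kernelDrift (a gam : ℝ) (n : ℕ) (t : ℝ) : ℝ :=
  2 * kernelS a gam n t - gam + (2 * n + gam - a - t + t * kernelR a gam n t) * kernelR a gam n t

theorem hasDerivAt_yhat (hgam : 0 < gam) (ha : lam + bet ≠ 0) {t : ℝ} (ht : 0 < t) (n : ℕ) :
    HasDerivAt (yhat lam bet gam n) (-(kernelDrift (lam + bet) gam n t /
      (t * (kernelR (lam + bet) gam n t - 1) ^ 2))) t := by
  have h1 := sub_ne_zero.2 (kernelR_ne_one (a := lam + bet) ht hgam ha n)
  have h2 := (((hasDerivAt_kernelR (a := lam + bet) ht hgam n).sub_const 1).inv h1).const_add 1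
  refine (h2.congr_deriv ?_).congr_of_eventuallyEq ?_
  · rw [kernelDrift]
    field_simp
  · filter_upwards [Ioi_mem_nhds ht] with s hs
    simpa using yhat_eq_kernelR hgam hs n

theorem yhat_painleve (hgam : 0 < gam) (ha : lam + bet ≠ 0) {t : ℝ} (ht : 0 < t) (n : ℕ) :
    deriv (deriv (yhat lam bet gam n)) t =
      (3 * yhat lam bet gam n t - 1) * deriv (yhat lam bet gam n) t ^ 2 /
          (2 * yhat lam bet gam n t * (yhat lam bet gam n t - 1))
        - deriv (yhat lam bet gam n) t / t
        + (yhat lam bet gam n t - 1) ^ 2 / (2 * t ^ 2) *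
          ((lam + bet) ^ 2 * yhat lam bet gam n t - gam ^ 2 / yhat lam bet gam n t)
        - (2 * n + 1 + gam - (lam + bet)) * yhat lam bet gam n t / t
        - yhat lam bet gam n t * (yhat lam bet gam n t + 1) /
          (2 * (yhat lam bet gam n t - 1)) := by
  have hR := hasDerivAt_kernelR (a := lam + bet) ht hgam n
  have hS := hasDerivAt_kernelS (a := lam + bet) ht hgam n
  have hw := sub_ne_zero.2 (kernelR_ne_one (a := lam + bet) ht hgam ha n)
  have hid := hasDerivAt_id t
  have hF := ((hS.const_mul 2).sub_const gam).add
    (((hid.const_sub (2 * n + gam - (lam + bet))).add (hid.mul hR)).mul hR)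
  have hD := (hF.div (hid.mul ((hR.sub_const 1).pow 2))
    (mul_ne_zero ht.ne' (pow_ne_zero 2 hw))).neg
  -- The first derivative is spelled as the combination of functions that `hD` differentiates.
  have hev : deriv (yhat lam bet gam n) =ᶠ[𝓝 t]
      -((fun x => 2 * kernelS (lam + bet) gam n x - gam) +
      ((fun x => 2 * n + gam - (lam + bet) - id x) + id * kernelR (lam + bet) gam n) *
        kernelR (lam + bet) gam n) / (id * (fun x => kernelR (lam + bet) gam n x - 1) ^ 2) := by
    filter_upwards [Ioi_mem_nhds ht] with s hs
    rw [(hasDerivAt_yhat hgam ha hs n).deriv, ← neg_div]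
    rfl
  rw [neg_div] at hev
  rw [hev.deriv_eq, hD.deriv]
  have key := painleve_five_algebra (n := n) ht.ne' hw
    (by rw [sub_add_cancel]; exact (kernelR_pos ht hgam n).ne')
    (by rw [sub_add_cancel]; exact kernelBeta_mul (a := lam + bet) ht hgam n)
    (by rw [sub_add_cancel]; rfl) rfl rfl rfl (yhat_eq_kernelR (lam := lam) hgam ht n)
    (hasDerivAt_yhat hgam ha ht n).deriv
  rw [← key, sub_add_cancel]
  simp only [Pi.add_apply, Pi.mul_apply, Pi.pow_apply, id, kernelDrift]
  push_cast
  ring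

theorem Hhat_eq_yhat (hgam : 0 < gam) (h : -1 < gam - (lam + bet)) (ha : lam + bet ≠ 0) {t : ℝ}
    (ht : 0 < t) (n : ℕ) :
    Hhat lam bet gam n t =
      (t * deriv (yhat lam bet gam n) t) ^ 2 /
          (4 * yhat lam bet gam n t * (yhat lam bet gam n t - 1) ^ 2)
        - ((lam + bet) * yhat lam bet gam n t - gam) ^ 2 / (4 * yhat lam bet gam n t)
        + t * (lam + bet - 2 * n) * yhat lam bet gam n t / (2 * (yhat lam bet gam n t - 1))
        - gam * t / (2 * (yhat lam bet gam n t - 1))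
        - t ^ 2 * yhat lam bet gam n t / (4 * (yhat lam bet gam n t - 1) ^ 2) := by
  refine hamiltonian_algebra ht.ne' (sub_ne_zero.2 (kernelR_ne_one ht hgam ha n))
    (by rw [sub_add_cancel]; exact (kernelR_pos ht hgam n).ne')
    (by rw [sub_add_cancel]; exact kernelBeta_mul (a := lam + bet) ht hgam n)
    (by rw [sub_add_cancel]; rfl) (Hhat_eq_kernelBeta hgam h ht n)
    (yhat_eq_kernelR (lam := lam) hgam ht n) (hasDerivAt_yhat hgam ha ht n).deriv

theorem kernelR_zero_sub_one {a : ℝ} (hgam : 0 < gam) (h : 0 < gam - a) (n : ℕ) :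
    kernelR a gam n 0 - 1 = a / (gam - a) := by
  rw [kernelR_zero hgam h, div_sub_one h.ne', sub_sub_cancel]

theorem yhat_zero (hgam : 0 < gam) (h : 0 < gam - (lam + bet)) (ha : lam + bet ≠ 0) (n : ℕ) :
    yhat lam bet gam n 0 = gam / (lam + bet) := by
  rw [yhat_eq_kernelR_of_nonneg hgam h le_rfl, kernelR_zero_sub_one hgam h]
  field_simp
  ring

theorem continuousWithinAt_yhat_zero (hgam : 0 < gam) (h : 0 < gam - (lam + bet))
    (ha : lam + bet ≠ 0) (n : ℕ) : ContinuousWithinAt (yhat lam bet gam n) (Ici 0) 0 := by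
  refine ContinuousWithinAt.congr (f := fun t => 1 + 1 / (kernelR (lam + bet) gam n t - 1)) ?_
    (fun t ht => yhat_eq_kernelR_of_nonneg hgam h ht n)
    (yhat_eq_kernelR_of_nonneg hgam h le_rfl n)
  refine continuousWithinAt_const.add (continuousWithinAt_const.div
    ((continuousWithinAt_kernelR_zero hgam h n).sub continuousWithinAt_const) ?_)
  rw [kernelR_zero_sub_one hgam h]
  exact div_ne_zero ha h.ne'

theorem hasDerivWithinAt_yhat_zero (hgam : 0 < gam) (h : 1 < gam - (lam + bet))
    (ha : lam + bet ≠ 0) (n : ℕ) :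
    HasDerivWithinAt (yhat lam bet gam n)
      (gam * (2 * n + 1 + gam - (lam + bet)) /
        ((lam + bet) * ((lam + bet - gam) ^ 2 - 1))) (Ici 0) 0 := by
  have h0 : 0 < gam - (lam + bet) := by linarith
  have h1 : kernelR (lam + bet) gam n 0 - 1 ≠ 0 := by
    rw [kernelR_zero_sub_one hgam h0]
    exact div_ne_zero ha h0.ne'
  have h2 := (((hasDerivWithinAt_kernelR_zero hgam h ha n).sub_const 1).inv h1).const_add 1
  refine (h2.congr_deriv ?_).congr (fun t ht => ?_) ?_
  · have h3 : 1 - (gam - (lam + bet)) ^ 2 ≠ 0 := by nlinarith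
    have h4 : (lam + bet - gam) ^ 2 - 1 ≠ 0 := by nlinarith
    rw [kernelR_zero_sub_one hgam h0]
    generalize lam + bet = a at *
    field_simp
    ring
  · simpa using yhat_eq_kernelR_of_nonneg hgam h0 ht n
  · simpa using yhat_eq_kernelR_of_nonneg hgam h0 le_rfl n

end Parameters

end PerturbedLaguerre

end

/-! ### The main theorem -/

theorem theorem8 (lam bet gam : ℝ) (hlam : lam < 0) (hbet : 0 < bet) (hgam : 0 < gam)
    (hpar : -1 < gam - lam - bet) (n : ℕ) (D R y H : ℝ → ℝ)
    (hD : D = PerturbedLaguerre.hankelDet lam bet gam n)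
    (hR : R = PerturbedLaguerre.Rhat lam bet gam n)
    (hy : y = PerturbedLaguerre.yhat lam bet gam n)
    (hH : H = PerturbedLaguerre.Hhat lam bet gam n) :
    -- the function `ŷ`, which is defined when `β + λ ≠ 0`
    (bet + lam ≠ 0 →
      ContDiffOn ℝ 2 y (Ioi 0) ∧
      (∀ t : ℝ, 0 < t → y t ≠ 0 ∧ y t ≠ 1 ∧ R t = 1 + 1 / (y t - 1)) ∧
      -- Painlevé V
      (∀ t : ℝ, 0 < t →
        deriv (deriv y) t =
          (3 * y t - 1) * deriv y t ^ 2 / (2 * y t * (y t - 1)) - deriv y t / t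
          + (y t - 1) ^ 2 / (2 * t ^ 2) * ((bet + lam) ^ 2 * y t - gam ^ 2 / y t)
          - (2 * n + 1 + gam - bet - lam) * y t / t
          - y t * (y t + 1) / (2 * (y t - 1))) ∧
      -- initial data
      (0 < gam - lam - bet →
        y 0 = gam / (bet + lam) ∧ ContinuousWithinAt y (Ici 0) 0) ∧
      (1 < gam - lam - bet →
        HasDerivWithinAt y
          (gam * (2 * n + 1 + gam - bet - lam) / ((bet + lam) * ((bet + lam - gam) ^ 2 - 1)))
          (Ici 0) 0) ∧
      -- `Ĥ_n` in terms of `ŷ` and `ŷ'`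
      (∀ t : ℝ, 0 < t →
        H t =
          (t * deriv y t) ^ 2 / (4 * y t * (y t - 1) ^ 2)
          - ((bet + lam) * y t - gam) ^ 2 / (4 * y t)
          + t * (bet + lam - 2 * n) * y t / (2 * (y t - 1))
          - gam * t / (2 * (y t - 1))
          - t ^ 2 * y t / (4 * (y t - 1) ^ 2))) ∧
    -- the function `Ĥ_n`
    (∀ t : ℝ, 0 ≤ t → 0 < D t) ∧
    (∀ t : ℝ, 0 < t →
      HasDerivAt (fun s => Real.log (D s / D 0))
        (-∑ j ∈ Finset.range n, PerturbedLaguerre.Rhat lam bet gam j t) t) ∧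
    ContDiffOn ℝ 2 H (Ioi 0) ∧
    (∀ t : ℝ, 0 < t →
      (t * deriv (deriv H) t) ^ 2 =
        4 * (n + deriv H t) * (H t - t * deriv H t) * (deriv H t - gam)
        + ((t - gam + bet + lam) * deriv H t - H t - n * gam) ^ 2) ∧
    PerturbedLaguerre.SatisfiesSigmaPV 0 (-n) (-bet - lam) (-n - gam)
      (fun t => H t + n * t + n * (bet + lam)) ∧
    H 0 = 0 ∧ ContinuousWithinAt H (Ici 0) 0 ∧
    (0 < gam - lam - bet →
      HasDerivWithinAt H (n * gam / (bet + lam - gam)) (Ici 0) 0) := by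
  subst hD hR hy hH
  have h : -1 < gam - (lam + bet) := by linarith
  refine ⟨fun ha => ?_, fun t ht => PerturbedLaguerre.hankelDet_pos hgam h ht n,
    fun t ht => PerturbedLaguerre.hasDerivAt_log_hankelDet hgam h ht n,
    PerturbedLaguerre.contDiffOn_Hhat hgam h 2 n, fun t ht => ?_,
    PerturbedLaguerre.satisfiesSigmaPV_Hhat hgam h n, PerturbedLaguerre.Hhat_zero n,
    PerturbedLaguerre.continuousWithinAt_Hhat_zero hgam h n, fun h0 => ?_⟩
  · have ha' : lam + bet ≠ 0 := by rwa [add_comm]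
    refine ⟨PerturbedLaguerre.contDiffOn_yhat hgam ha' 2 n,
      fun t ht => PerturbedLaguerre.yhat_ne hgam ha' ht n, fun t ht => ?_,
      fun h0 => ⟨?_, PerturbedLaguerre.continuousWithinAt_yhat_zero hgam (by linarith) ha' n⟩,
      fun h1 => ?_, fun t ht => ?_⟩
    · rw [PerturbedLaguerre.yhat_painleve hgam ha' ht n]
      ring
    · rw [add_comm bet lam]
      exact PerturbedLaguerre.yhat_zero hgam (by linarith) ha' n
    · refine (PerturbedLaguerre.hasDerivWithinAt_yhat_zero hgam (by linarith) ha' n).congr_deriv ?_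
      rw [add_comm bet lam, show 2 * (n : ℝ) + 1 + gam - bet - lam =
        2 * n + 1 + gam - (lam + bet) by ring]
    · rw [add_comm bet lam]
      exact PerturbedLaguerre.Hhat_eq_yhat hgam h ha' ht n
  · rw [PerturbedLaguerre.Hhat_sigma hgam h ht n]
    ring
  · rw [add_comm bet lam]
    exact PerturbedLaguerre.hasDerivWithinAt_Hhat_zero hgam (by linarith) n
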